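/- Let $1\le d\le n$ and let $M=\{F=0\}\subset\mathbb{CP}^n$ be a smooth hypersurface, where $F\in\mathbb{C}[Z_0,\dots,Z_n]$ is homogeneous of degree $d$ and the partial derivatives $F_k=\partial F/\partial Z_k$ $(0\le k\le n)$ have no common zero on $M$. Let $\omega=\frac{\sqrt{-1}}{2\pi}\sum_{i,j}\tilde g_{i\bar j}\,dz_i\wedge d\bar z_j$ be the restriction to $M$ of the Fubini–Study form of $\mathbb{CP}^n$ (given in the affine chart $z_i=Z_i/Z_0$ by $\frac{\sqrt{-1}}{2\pi}\sum_{i,j=1}^n\big(\frac{\delta_{ij}}{1+|z|^2}-\frac{\bar z_iz_j}{(1+|z|^2)^2}\big)dz_i\wedge d\bar z_j$), and put $$\xi=\log\frac{\sum_{k=0}^n|F_k|^2}{\big(\sum_{k=0}^n|Z_k|^2\big)^{d-1}},$$ a function on $M$. In local holomorphic coordinates on $M$ let $\Theta=(\Theta_k^\ell)$, $\Theta_k^\ell=\frac{\sqrt{-1}}{2\pi}\sum_{i,j}R^{\ell}_{k i\bar j}\,dz_i\wedge d\bar z_j$ with $R^{\ell}_{ki\bar j}=-\frac{\partial}{\partial\bar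 z_j}\Big(\sum_s\frac{\partial\tilde g_{k\bar s}}{\partial z_i}\tilde g^{\ell\bar s}\Big)$, be the curvature of $\tilde g$ on the holomorphic tangent bundle, and define the Chern forms $c_q(\Theta)=P^q(\Theta)$ by $\det(\Theta+tI)=\sum_{q=0}^{n-1}P^q(\Theta)\,t^{\,n-1-q}$. Let the numbers $\alpha_{qk}$ $(0\le k\le q\le n-1)$ be determined by $\alpha_{00}=1$ and, for $q=1,\dots,n-1$, $$\alpha_{qq}=\binom{n+1}{q}-d\,\alpha_{(q-1)(q-1)},\qquad \alpha_{q(q-k)}=-\big(d\,\alpha_{(q-1)(q-k-1)}+\alpha_{(q-1)(q-k)}\big)\ (1\le k\le q-1),\qquad \alpha_{q0}=(-1)^q .$$ Then, everywhere on $M$, for $q=1,\dots,n-1$, $$c_q(\Theta)=\sum_{k=0}^{q}\alpha_{qk}\,\omega^k\wedge\Big(\frac{\sqrt{-1}}{2\pi}\partial\bar\partial\xi\Big)^{q-k}.$$ Moreover, integers $\alpha_{qk}$ satisfy the above recursion if and only if $$\alpha_{qk}=(-1)^q\sum_{\ell=0}^{k}(-1)^\ell d^{\,k-\ell}\binom{q-\ell}{k-\ell}\binom{n+1}{\ell}\qquad(0\le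 k\le q\le n-1).$$ -/

import Mathlib

open scoped LinearAlgebra.Projectivization

noncomputable section

namespace ChernHypersurface

/-! ### Differential forms of even degree on an open subset of `ℂ^m`

The complexified cotangent space of `ℂ^m` at a point consists of the `ℝ`-linear maps `ℂ^m → ℂ`.
A complex form of even degree at a point is an element of the even part of the exterior algebra
over `ℂ` of that space; the product is the wedge product, and it is commutative. -/

/-- The complexified cotangent space of `ℂ^m` at a point. -/
abbrev Cotangent (m : ℕ) : Type := (Fin m → ℂ) →ₗ[ℝ] ℂ

/-- The covector `dz_i`. -/
def dz {m : ℕ} (i : Fin m) : Cotangent m := LinearMap.proj i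

/-- The covector `d\bar z_i`. -/
def dzbar {m : ℕ} (i : Fin m) : Cotangent m :=
  Complex.conjAe.toLinearMap ∘ₗ (LinearMap.proj i : (Fin m → ℂ) →ₗ[ℝ] ℂ)

/-- Complex forms of even degree at a point of `ℂ^m`: the even part of the exterior algebra
(recall that `ExteriorAlgebra ℂ V` is the Clifford algebra of the zero quadratic form on `V`). -/
abbrev EvenForm (m : ℕ) : Type :=
  CliffordAlgebra.even (0 : QuadraticForm ℂ (Cotangent m))

theorem ι_mul_ι_swap {m : ℕ} (a b : Cotangent m) :
    ExteriorAlgebra.ι ℂ a * ExteriorAlgebra.ι ℂ b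
      = -(ExteriorAlgebra.ι ℂ b * ExteriorAlgebra.ι ℂ a) :=
  eq_neg_of_add_eq_zero_left (ExteriorAlgebra.ι_add_mul_swap a b)

theorem ι_mul_ι_comm {m : ℕ} (a b : Cotangent m) (y : ExteriorAlgebra ℂ (Cotangent m)) :
    ExteriorAlgebra.ι ℂ a * ExteriorAlgebra.ι ℂ b * y
      = y * (ExteriorAlgebra.ι ℂ a * ExteriorAlgebra.ι ℂ b) := by
  induction y using ExteriorAlgebra.induction with
  | algebraMap r => exact (Algebra.commutes r _).symm
  | ι c =>
    rw [mul_assoc, ι_mul_ι_swap b c, mul_neg, ← mul_assoc, ι_mul_ι_swap a c, neg_mul, neg_neg,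
      mul_assoc]
  | mul x y hx hy => rw [← mul_assoc, hx, mul_assoc, hy, mul_assoc]
  | add x y hx hy => rw [mul_add, add_mul, hx, hy]

theorem evenForm_mul_comm {m : ℕ} (x y : EvenForm m) : x * y = y * x := by
  obtain ⟨x, hx⟩ := x
  obtain ⟨y, hy⟩ := y
  apply Subtype.ext
  change x * y = y * x
  clear hy
  induction x, hx using CliffordAlgebra.even_induction with
  | algebraMap r => exact Algebra.commutes r _
  | add x₁ x₂ _ _ h₁ h₂ => rw [add_mul, mul_add, h₁, h₂]
  | ι_mul_ι_mul a b x _ h =>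
    have hc := ι_mul_ι_comm a b y
    change CliffordAlgebra.ι 0 a * CliffordAlgebra.ι 0 b * y = _ at hc
    rw [mul_assoc _ x y, h, ← mul_assoc, hc, mul_assoc y]

instance instCommRingEvenForm (m : ℕ) : CommRing (EvenForm m) :=
  { (inferInstance : Ring (EvenForm m)) with mul_comm := evenForm_mul_comm }

/-- The `(1,1)`-form `dz_i ∧ d\bar z_j`. -/
def dzWedgeDzbar {m : ℕ} (i j : Fin m) : EvenForm m :=
  ⟨ExteriorAlgebra.ι ℂ (dz i) * ExteriorAlgebra.ι ℂ (dzbar j),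
    CliffordAlgebra.ι_mul_ι_mem_evenOdd_zero _ _ _⟩

/-- The `(1,1)`-form `(√-1 / 2π) ∑_{i,j} h_{i\bar j} dz_i ∧ d\bar z_j`. -/
def oneOneForm {m : ℕ} (h : Matrix (Fin m) (Fin m) ℂ) : EvenForm m :=
  (Complex.I / (2 * (Real.pi : ℂ))) • ∑ i, ∑ j, h i j • dzWedgeDzbar i j

/-! ### Wirtinger derivatives and `∂∂̄` -/

/-- `∂u/∂z_i = (∂u/∂x_i - √-1 ∂u/∂y_i) / 2`. -/
def wirtinger {m : ℕ} (i : Fin m) (u : (Fin m → ℂ) → ℂ) (x : Fin m → ℂ) : ℂ :=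
  (fderiv ℝ u x (Pi.single i 1) - Complex.I * fderiv ℝ u x (Pi.single i Complex.I)) / 2

/-- `∂u/∂\bar z_i = (∂u/∂x_i + √-1 ∂u/∂y_i) / 2`. -/
def wirtingerBar {m : ℕ} (i : Fin m) (u : (Fin m → ℂ) → ℂ) (x : Fin m → ℂ) : ℂ :=
  (fderiv ℝ u x (Pi.single i 1) + Complex.I * fderiv ℝ u x (Pi.single i Complex.I)) / 2

/-- The form `(√-1 / 2π) ∂∂̄u`. -/
def ddbar {m : ℕ} (u : (Fin m → ℂ) → ℂ) (x : Fin m → ℂ) : EvenForm m :=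
  oneOneForm (Matrix.of fun i j => wirtinger i (wirtingerBar j u) x)

/-! ### Curvature and Chern forms of a Hermitian metric `g = (g_{i\bar j})` in coordinates -/

/-- `R_{k i \bar j}^ℓ = -∂_{\bar j} (∑_s (∂_i g_{k\bar s}) g^{ℓ\bar s})`, the curvature of the
metric; `g^{ℓ\bar s}` is the `(s, ℓ)` entry of the inverse matrix, so that
`∑_s g_{k\bar s} g^{ℓ\bar s} = δ_{kℓ}`. -/
def curvatureTensor {m : ℕ} (g : (Fin m → ℂ) → Matrix (Fin m) (Fin m) ℂ)
    (l k i j : Fin m) (x : Fin m → ℂ) : ℂ :=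
  -wirtingerBar j (fun y => ∑ s, wirtinger i (fun w => g w k s) y * (g y)⁻¹ s l) x

/-- The matrix of `(1,1)`-forms
`Θ_k^ℓ = (√-1 / 2π) ∑_{i,j} R_{k i \bar j}^ℓ dz_i ∧ d\bar z_j`. -/
def curvatureForm {m : ℕ} (g : (Fin m → ℂ) → Matrix (Fin m) (Fin m) ℂ) (x : Fin m → ℂ) :
    Matrix (Fin m) (Fin m) (EvenForm m) :=
  Matrix.of fun k l => oneOneForm (Matrix.of fun i j => curvatureTensor g l k i j x)

/-- The `q`-th Chern form `P^q(Θ)`, where `det (Θ + t I) = ∑_{q ≤ m} P^q(Θ) t^{m-q}`. -/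
def chernForm {m : ℕ} (g : (Fin m → ℂ) → Matrix (Fin m) (Fin m) ℂ) (q : ℕ) (x : Fin m → ℂ) :
    EvenForm m :=
  ((curvatureForm g x).map Polynomial.C
    + (Polynomial.X : Polynomial (EvenForm m)) • (1 : Matrix (Fin m) (Fin m) _)).det.coeff (m - q)

/-! ### Projective hypersurfaces -/

/-- The zero locus in `ℂP^n` of a homogeneous polynomial (whether `F` vanishes at a representative
does not depend on the representative). -/
def hypersurface {n : ℕ} (F : MvPolynomial (Fin (n + 1)) ℂ) : Set (ℙ ℂ (Fin (n + 1) → ℂ)) :=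
  {p | MvPolynomial.eval p.rep F = 0}

/-- `F` has no critical point on its zero locus away from the origin. -/
def IsNonsingular {n : ℕ} (F : MvPolynomial (Fin (n + 1)) ℂ) : Prop :=
  ∀ Z : Fin (n + 1) → ℂ, Z ≠ 0 → MvPolynomial.eval Z F = 0 →
    ∃ k, MvPolynomial.eval Z (MvPolynomial.pderiv k F) ≠ 0

/-- The Fubini-Study Hermitian form at the point `[Z]` of `ℂP^n`, evaluated on the images of the
vectors `v`, `w` of `ℂ^{n+1}` under the differential of `Z ↦ [Z]`. At `Z = (1, z)` and on the
coordinate vectors `∂/∂z_i`, `∂/∂z_j` it is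
`δ_{ij} / (1 + |z|²) - \bar z_i z_j / (1 + |z|²)²`. -/
def fubiniStudy {n : ℕ} (Z v w : Fin (n + 1) → ℂ) : ℂ :=
  (∑ a, v a * star (w a)) / ((∑ a, ‖Z a‖ ^ 2 : ℝ) : ℂ)
    - (∑ a, v a * star (Z a)) * (∑ a, Z a * star (w a)) / ((∑ a, ‖Z a‖ ^ 2 : ℝ) : ℂ) ^ 2

/-- A local holomorphic parametrization `x ↦ [φ(x)]` of the hypersurface `F = 0` by an open subset
of `ℂ^m`, given by a holomorphic lift `φ` to homogeneous coordinates. It is an immersion into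
`ℂP^n`: the kernel of the differential of `Z ↦ [Z]` at `φ(x)` is the line `ℂ φ(x)`. When the
hypersurface is a complex manifold of dimension `m`, these are, up to shrinking the domain, the
holomorphic coordinate systems on it. -/
structure LocalParam {n : ℕ} (F : MvPolynomial (Fin (n + 1)) ℂ) (m : ℕ) where
  dom : Set (Fin m → ℂ)
  isOpen_dom : IsOpen dom
  lift : (Fin m → ℂ) → (Fin (n + 1) → ℂ)
  holomorphic : DifferentiableOn ℂ lift dom
  lift_ne_zero : ∀ x ∈ dom, lift x ≠ 0
  mem_hypersurface : ∀ (x : Fin m → ℂ) (hx : x ∈ dom),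
    Projectivization.mk ℂ (lift x) (lift_ne_zero x hx) ∈ hypersurface F
  immersive : ∀ x ∈ dom, ∀ (v : Fin m → ℂ) (c : ℂ), fderiv ℂ lift x v = c • lift x → v = 0

namespace LocalParam

variable {n m : ℕ} {F : MvPolynomial (Fin (n + 1)) ℂ}

/-- The coefficients `g_{i\bar j}` of the Fubini-Study metric restricted to the hypersurface, in
the coordinates given by the parametrization. -/
def metric (φ : LocalParam F m) (x : Fin m → ℂ) : Matrix (Fin m) (Fin m) ℂ :=
  Matrix.of fun i j =>
    fubiniStudy (φ.lift x) (fderiv ℂ φ.lift x (Pi.single i 1)) (fderiv ℂ φ.lift x (Pi.single j 1))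

/-- The restricted Kähler form `ω = (√-1 / 2π) ∑ g_{i\bar j} dz_i ∧ d\bar z_j`. -/
def kahlerForm (φ : LocalParam F m) (x : Fin m → ℂ) : EvenForm m :=
  oneOneForm (φ.metric x)

end LocalParam

/-- `ξ = log (∑_k |F_k|² / (∑_k |Z_k|²)^{d-1})` with `F_k = ∂F/∂Z_k`, in homogeneous
coordinates. -/
def xi {n : ℕ} (F : MvPolynomial (Fin (n + 1)) ℂ) (d : ℕ) (Z : Fin (n + 1) → ℂ) : ℝ :=
  Real.log ((∑ k, ‖MvPolynomial.eval Z (MvPolynomial.pderiv k F)‖ ^ 2)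
    / (∑ k, ‖Z k‖ ^ 2) ^ (d - 1))

/-- The recursion that defines the coefficients `α_{qk}`, `0 ≤ k ≤ q ≤ n - 1`. -/
structure IsChernCoeff (n d : ℕ) (α : ℕ → ℕ → ℤ) : Prop where
  zero : α 0 0 = 1
  top : ∀ q, 1 ≤ q → q ≤ n - 1 → α q q = ((n + 1).choose q : ℤ) - d * α (q - 1) (q - 1)
  mid : ∀ q, 1 ≤ q → q ≤ n - 1 → ∀ k, 1 ≤ k → k ≤ q - 1 →
    α q (q - k) = -(d * α (q - 1) (q - k - 1) + α (q - 1) (q - k))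
  bot : ∀ q, 1 ≤ q → q ≤ n - 1 → α q 0 = (-1) ^ q

end ChernHypersurface

end

/-! ### Jacobi's formula and the characteristic polynomial of `w • 1 + A + B`. -/

noncomputable section
namespace ChernHypersurface

/-! Put `m = n - 1`, `w = ω`. The gradient `N = (F_k)` is holomorphic along `M` and is annihilated,
for the bilinear dot product, by `Z` (Euler) and by the `∂_k Z` (differentiate `F = 0`). So `star N`
is normal to `M`, and the Gauss equation (`NormalFrame.curvatureTensor_metric`) reads `R = δ_{kl}
g_{ij} + δ_{il} g_{kj} - h_{ki} E_{lj}`, with `h` the second fundamental form and `E` its adjoint.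

Hence `Θ = w • 1 + A + B`, where every entry of `A` and of `B` is a one-form indexed by the row
wedged with a one-form indexed by the column. Such matrices multiply like rank-one matrices, except
for a sign caused by anticommutation: `A² = -w A`, `B² = t B`, `tr A = w`, `tr B = -t`. The symmetry
of `h`, and of `E` with its index lowered, gives `AB = BA = 0`. Jacobi's formula turns this into a
differential equation for the determinant whose solution is `X (X + w + t) det (Θ + X) = (X +
w)^(m+2)`; comparing coefficients, `c_{q+1} + (w + t) c_q = (n+1 choose q+1) w^{q+1}`
(`coeff_det_of_orthogonal`, `chernForm_succ_add`).

The form `t` is the pullback of the Fubini-Study form by the Gauss map `[N]`, that is `(√-1 / 2π)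
∂∂̄ log |N|²`. As `ξ = log |N|² - (d - 1) log |Z|²`, it follows that `w + t = d ω + (√-1 / 2π) ∂∂̄ξ`
(`LocalParam.ddbar_xi`). The resulting recursion for the Chern forms is, coefficient by coefficient,
the one for `α`, and Pascal's rule gives its closed solution. -/

theorem derivative_det {R ι : Type*} [CommRing R] [Fintype ι] [DecidableEq ι]
    (M : Matrix ι ι (Polynomial R)) :
    Polynomial.derivative M.det =
      ∑ j, (M.updateCol j fun i => Polynomial.derivative (M i j)).det := by
  simp only [Matrix.det_apply', map_sum]
  rw [Finset.sum_comm]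
  refine Finset.sum_congr rfl fun σ _ => ?_
  rw [Polynomial.derivative_mul, Polynomial.derivative_intCast, zero_mul, zero_add,
    ← Finset.mul_sum, Polynomial.derivative_prod_finset]
  congr 1
  refine Finset.sum_congr rfl fun a _ => ?_
  rw [← Finset.prod_erase_mul _ _ (Finset.mem_univ a), Matrix.updateCol_self]
  congr 1
  refine Finset.prod_congr rfl fun b hb => ?_
  rw [Matrix.updateCol_ne (Finset.ne_of_mem_erase hb)]

/-- Jacobi's formula: differentiating column `j` of `A + X` leaves the `j`-th unit vector, so each
summand is a diagonal entry of the adjugate. -/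
theorem derivative_det_add_X {R ι : Type*} [CommRing R] [Fintype ι] [DecidableEq ι]
    (A : Matrix ι ι R) :
    Polynomial.derivative
        (A.map Polynomial.C + (Polynomial.X : Polynomial R) • (1 : Matrix ι ι _)).det =
      (A.map Polynomial.C + (Polynomial.X : Polynomial R) • (1 : Matrix ι ι _)).adjugate.trace := by
  rw [derivative_det, ← Matrix.trace_transpose, Matrix.adjugate_transpose, Matrix.trace]
  refine Finset.sum_congr rfl fun i _ => ?_
  rw [Matrix.diag_apply, Matrix.adjugate_apply, Matrix.updateRow_transpose, Matrix.det_transpose]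
  congr 2
  ext j : 1
  by_cases h : j = i <;> simp [h]

/-- The equation is the one satisfied by `(X + w)^N`. It determines the coefficients downwards from
degree `N`; each step divides by `j + 1`, whence the torsion-freeness. -/
theorem coeff_eq_of_mul_derivative {R : Type*} [CommRing R] [IsAddTorsionFree R] {q : Polynomial R}
    {w : R} {N : ℕ} (hq : q.coeff N = 1)
    (h : (Polynomial.X + Polynomial.C w) * Polynomial.derivative q = (N : Polynomial R) * q)
    (j : ℕ) (hj : j ≤ N) : q.coeff (N - j) = (N.choose j : R) * w ^ j := by
  induction j with
  | zero => simp [hq]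
  | succ j ih =>
    have ih := ih (by omega)
    obtain ⟨k, hk⟩ : ∃ k, N - (j + 1) = k := ⟨_, rfl⟩
    have hk' : N - j = k + 1 := by omega
    have hc := congrArg (fun p => Polynomial.coeff p k) h
    simp only [add_mul, Polynomial.coeff_add, Polynomial.coeff_C_mul, Polynomial.coeff_derivative,
      ← Polynomial.C_eq_natCast] at hc
    rw [hk'] at ih
    have hX : (Polynomial.X * Polynomial.derivative q).coeff k = k * q.coeff k := by
      cases k <;> simp [Polynomial.coeff_X_mul, Polynomial.coeff_derivative, mul_comm]
    rw [hX, ih] at hc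
    rw [hk]
    have hN : (N : R) = k + (j + 1) := by
      have : N = k + (j + 1) := by omega
      exact_mod_cast congrArg (Nat.cast : ℕ → R) this
    have hch : (N.choose (j + 1) : R) * (j + 1) = N.choose j * (k + 1) := by
      have := Nat.choose_succ_right_eq N j
      rw [hk'] at this
      exact_mod_cast congrArg (Nat.cast : ℕ → R) this
    have : (j + 1) • q.coeff k = (j + 1) • ((N.choose (j + 1) : R) * w ^ (j + 1)) := by
      rw [nsmul_eq_mul, nsmul_eq_mul]
      push_cast
      rw [hN] at hc
      linear_combination -hc - w ^ (j + 1) * hch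
    exact nsmul_right_injective (by omega) this

open Polynomial in

/-- The characteristic polynomial of a perturbation of a scalar matrix by two orthogonal
matrices which are, up to sign, idempotent up to their traces. -/
theorem coeff_det_of_orthogonal {R ι : Type*} [CommRing R] [IsAddTorsionFree R] [Fintype ι]
    [DecidableEq ι] {A B : Matrix ι ι R} {w t : R} (hA : A * A = -w • A) (hB : B * B = t • B)
    (hAB : A * B = 0) (hBA : B * A = 0) (htA : A.trace = w) (htB : B.trace = -t) (k : ℕ)
    (hk : k + 1 ≤ Fintype.card ι) :
    ((w • (1 : Matrix ι ι R) + A + B).map C + (X : R[X]) • (1 : Matrix ι ι R[X])).det.coeff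
        (Fintype.card ι - (k + 1))
      + (w + t) * ((w • (1 : Matrix ι ι R) + A + B).map C
        + (X : R[X]) • (1 : Matrix ι ι R[X])).det.coeff (Fintype.card ι - k)
      = ((Fintype.card ι + 2).choose (k + 1) : R) * w ^ (k + 1) := by
  nontriviality R
  set m := Fintype.card ι with hm
  set P := (w • (1 : Matrix ι ι R) + A + B).map C + (X : R[X]) • (1 : Matrix ι ι R[X]) with hP
  set p := P.det with hp
  set A' : Matrix ι ι R[X] := A.map C
  set B' : Matrix ι ι R[X] := B.map C
  have hA' : A' * A' = -C w • A' := by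
    have := congrArg (fun M : Matrix ι ι R => M.map (C : R →+* R[X])) hA
    simp only [Matrix.map_mul] at this
    rw [show A' * A' = _ from this]
    ext i j : 2
    simp [A']
  have hB' : B' * B' = C t • B' := by
    have := congrArg (fun M : Matrix ι ι R => M.map (C : R →+* R[X])) hB
    simp only [Matrix.map_mul] at this
    rw [show B' * B' = _ from this]
    ext i j : 2
    simp [B']
  have hAB' : A' * B' = 0 := by
    have := congrArg (fun M : Matrix ι ι R => M.map (C : R →+* R[X])) hAB
    simp only [Matrix.map_mul] at this
    rw [show A' * B' = _ from this]
    ext i j : 2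
    simp
  have hBA' : B' * A' = 0 := by
    have := congrArg (fun M : Matrix ι ι R => M.map (C : R →+* R[X])) hBA
    simp only [Matrix.map_mul] at this
    rw [show B' * A' = _ from this]
    ext i j : 2
    simp
  have htA' : A'.trace = C w := by rw [← htA, Matrix.trace, Matrix.trace, map_sum]; rfl
  have htB' : B'.trace = -C t := by
    rw [← map_neg, ← htB, Matrix.trace, Matrix.trace, map_sum]; rfl
  have hP' : P = (X + C w) • (1 : Matrix ι ι R[X]) + A' + B' := by
    rw [hP]
    ext i j : 2
    by_cases h : i = j
    · simp [A', B', h]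
      ring
    · simp [A', B', h]
  -- `P⁻¹` with denominators cleared: for `s = X + w`, the relations on `A` and `B` give `s P⁻¹ = 1
  -- - A / (s - w) - B / (s + t)`.
  set Q : Matrix ι ι R[X] := (X * (X + C w + C t)) • (1 : Matrix ι ι R[X]) - (X + C w + C t) • A' - (X : R[X]) • B' with hQ
  have hPQ : P * Q = ((X + C w) * (X * (X + C w + C t))) • (1 : Matrix ι ι R[X]) := by
    rw [hP', hQ]
    simp only [add_mul, mul_sub, Matrix.smul_mul, Matrix.mul_smul, hA', hB', hAB', hBA', one_mul,
      mul_one, smul_zero, smul_smul]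
    module
  -- Multiplying `P * Q` by the adjugate of `P` and taking traces yields the logarithmic derivative
  -- of `p`, without inverting any element.
  have hder : derivative p * ((X + C w) * (X * (X + C w + C t))) =
      p * ((m : R[X]) * (X * (X + C w + C t)) - (X + C w + C t) * C w + X * C t) := by
    have h1 : P.adjugate * (P * Q) = p • Q := by
      rw [← mul_assoc, Matrix.adjugate_mul, Matrix.smul_mul, one_mul]
    rw [hPQ, Matrix.mul_smul, mul_one] at h1
    have h2 := congrArg Matrix.trace h1
    rw [Matrix.trace_smul, Matrix.trace_smul, ← derivative_det_add_X, hQ, Matrix.trace_sub,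
      Matrix.trace_sub, Matrix.trace_smul, Matrix.trace_smul, Matrix.trace_smul, Matrix.trace_one,
      htA', htB'] at h2
    simp only [smul_eq_mul] at h2
    rw [mul_comm, h2]
    ring
  have hmonic : p.Monic ∧ p.natDegree = m := by
    have : p = (-(w • (1 : Matrix ι ι R) + A + B)).charpoly := by
      rw [hp, hP, Matrix.charpoly]
      congr 1
      ext i j : 2
      by_cases h : i = j
      · simp [Matrix.charmatrix, h]
        ring
      · simp [Matrix.charmatrix, h]
    rw [this]
    exact ⟨Matrix.charpoly_monic _, Matrix.charpoly_natDegree_eq_dim _⟩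
  -- The factors `X` and `X + w + t` absorb the two correction terms of `hder`, so that `q`
  -- satisfies the equation of `(X + w)^(m + 2)`.
  set q := X * (p * (X + C (w + t))) with hq
  have hcoeff : ∀ i, q.coeff (i + 2) = p.coeff i + (w + t) * p.coeff (i + 1) := by
    intro i
    rw [hq, coeff_X_mul, mul_add, coeff_add, coeff_mul_X, coeff_mul_C, mul_comm]
  have hlead : q.coeff (m + 2) = 1 := by
    rw [hcoeff, coeff_eq_zero_of_natDegree_lt (n := m + 1) (by omega), mul_zero, add_zero,
      ← hmonic.2, hmonic.1.coeff_natDegree]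
  have hode : (X + C w) * derivative q = ((m + 2 : ℕ) : R[X]) * q := by
    rw [hq]
    simp only [derivative_mul, derivative_X, derivative_C, map_add]
    push_cast
    linear_combination hder
  have := coeff_eq_of_mul_derivative hlead hode (k + 1) (by omega)
  rw [← this, show m + 2 - (k + 1) = (m - (k + 1)) + 2 by omega, hcoeff,
    show m - (k + 1) + 1 = m - k by omega]

end ChernHypersurface
end

/-! ### Matrices of wedge products and the recursion forced by the Gauss equation. -/

noncomputable section
namespace ChernHypersurface

instance instIsAddTorsionFreeEvenForm (m : ℕ) : IsAddTorsionFree (EvenForm m) :=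
  have : Module ℚ (EvenForm m) := Module.compHom _ (algebraMap ℚ ℂ)
  .of_module_rat _

/-- The wedge product of two covectors. -/
def wedge {m : ℕ} : Cotangent m →ₗ[ℂ] Cotangent m →ₗ[ℂ] EvenForm m :=
  LinearMap.mk₂ ℂ (fun a b => ⟨ExteriorAlgebra.ι ℂ a * ExteriorAlgebra.ι ℂ b,
      CliffordAlgebra.ι_mul_ι_mem_evenOdd_zero _ _ _⟩)
    (fun a a' b => Subtype.ext (by simp [add_mul])) (fun c a b => Subtype.ext (by simp))
    (fun a b b' => Subtype.ext (by simp [mul_add])) (fun c a b => Subtype.ext (by simp))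

theorem wedge_swap {m : ℕ} (a b : Cotangent m) : wedge a b = -wedge b a :=
  Subtype.ext (ι_mul_ι_swap a b)

theorem wedge_mul_wedge {m : ℕ} (a b a' b' : Cotangent m) :
    wedge a b * wedge a' b' = -(wedge a' b * wedge a b') := by
  rw [wedge_swap a' b, neg_mul, neg_neg]
  apply Subtype.ext
  change ExteriorAlgebra.ι ℂ a * ExteriorAlgebra.ι ℂ b *
      (ExteriorAlgebra.ι ℂ a' * ExteriorAlgebra.ι ℂ b') =
    ExteriorAlgebra.ι ℂ b * ExteriorAlgebra.ι ℂ a' *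
      (ExteriorAlgebra.ι ℂ a * ExteriorAlgebra.ι ℂ b')
  rw [ι_mul_ι_comm b a']
  simp only [mul_assoc]
  rw [← mul_assoc _ _ (ExteriorAlgebra.ι ℂ b * _), ← mul_assoc (ExteriorAlgebra.ι ℂ b),
    ι_mul_ι_comm b a', mul_assoc]

/-- The rank-one rule `(u vᵀ)(u' v'ᵀ) = (v · u') u v'ᵀ`; the sign comes from exchanging the odd
factors `u k` and `u' l`. -/
theorem of_wedge_mul_of_wedge {m : ℕ} (u v u' v' : Fin m → Cotangent m) :
    (Matrix.of fun k l => wedge (u k) (v l)) * (Matrix.of fun k l => wedge (u' k) (v' l)) =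
      -(∑ l, wedge (u' l) (v l)) • Matrix.of fun k l => wedge (u k) (v' l) := by
  ext k j : 1
  simp only [Matrix.mul_apply, Matrix.of_apply, Matrix.smul_apply, smul_eq_mul, neg_mul,
    Finset.sum_mul]
  rw [← Finset.sum_neg_distrib]
  exact Finset.sum_congr rfl fun l _ => wedge_mul_wedge _ _ _ _

theorem sum_sum_smul_wedge_eq_zero {m : ℕ} (s : Fin m → Fin m → ℂ) (hs : ∀ i j, s i j = s j i)
    (a : Fin m → Cotangent m) : ∑ i, ∑ j, s i j • wedge (a i) (a j) = 0 := by
  refine self_eq_neg.1 ?_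
  conv_lhs => rw [Finset.sum_comm]
  simp only [← Finset.sum_neg_distrib]
  refine Finset.sum_congr rfl fun i _ => Finset.sum_congr rfl fun j _ => ?_
  rw [hs, wedge_swap, smul_neg]

theorem wedge_sum_smul {m : ℕ} {ι κ : Type*} [Fintype ι] [Fintype κ] (s : ι → ℂ) (t : κ → ℂ)
    (a : ι → Cotangent m) (b : κ → Cotangent m) :
    wedge (∑ i, s i • a i) (∑ j, t j • b j) = ∑ i, ∑ j, (s i * t j) • wedge (a i) (b j) := by
  simp only [map_sum, map_smul, LinearMap.sum_apply, LinearMap.smul_apply, Finset.smul_sum,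
    smul_smul]
  rw [Finset.sum_comm]
  simp only [mul_comm]

/-- The Chern forms of a matrix of `(1,1)`-forms given by the Gauss equation. -/
theorem chernForm_succ_add {m : ℕ} (g : (Fin m → ℂ) → Matrix (Fin m) (Fin m) ℂ) (x : Fin m → ℂ)
    (h E : Matrix (Fin m) (Fin m) ℂ) (hh : ∀ i j, h i j = h j i)
    (hE : ∀ j p, ∑ l, E l j * g x l p = ∑ l, E l p * g x l j)
    (hR : ∀ l k i j, curvatureTensor g l k i j x =
      (if k = l then g x i j else 0) + (if i = l then g x k j else 0) - h k i * E l j)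
    (q : ℕ) (hq : q + 1 ≤ m) :
    chernForm g (q + 1) x + (oneOneForm (g x) +
        oneOneForm (Matrix.of fun i j => ∑ l, h l i * E l j)) * chernForm g q x =
      ((m + 2).choose (q + 1) : EvenForm m) * oneOneForm (g x) ^ (q + 1) := by
  set c : ℂ := Complex.I / (2 * (Real.pi : ℂ)) with hc
  set w := oneOneForm (g x)
  set t := oneOneForm (Matrix.of fun i j => ∑ l, h l i * E l j)
  -- The row covectors `β`, `a` and the column covectors `dz`, `e` are chosen so that `A` comes from
  -- the term `δ_{il} g_{kj}` and `B` from `-h_{ki} E_{lj}`. The sign in `β` compensates for putting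
  -- `dz l` second.
  set β : Fin m → Cotangent m := fun k => -(c • ∑ j, g x k j • dzbar j) with hβ
  set a : Fin m → Cotangent m := fun k => -(c • ∑ i, h k i • dz i) with ha
  set e : Fin m → Cotangent m := fun l => ∑ j, E l j • dzbar j with he
  set A : Matrix (Fin m) (Fin m) (EvenForm m) := Matrix.of fun k l => wedge (β k) (dz l) with hA
  set B : Matrix (Fin m) (Fin m) (EvenForm m) := Matrix.of fun k l => wedge (a k) (e l) with hB
  have hform : ∀ M : Matrix (Fin m) (Fin m) ℂ,
      oneOneForm M = c • ∑ i, ∑ j, M i j • wedge (dz i) (dzbar j) := fun M => rfl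
  have hβdz : ∀ k l, wedge (β k) (dz l) = c • ∑ j, g x k j • wedge (dz l) (dzbar j) := by
    intro k l
    rw [wedge_swap]
    simp only [hβ, map_neg, neg_neg, map_smul, map_sum]
  have hae : ∀ k l, wedge (a k) (e l) =
      -(c • ∑ i, ∑ j, (h k i * E l j) • wedge (dz i) (dzbar j)) := by
    intro k l
    simp only [ha, he, map_neg, LinearMap.neg_apply, map_smul, LinearMap.smul_apply,
      wedge_sum_smul]
  have hΘ : curvatureForm g x = w • (1 : Matrix (Fin m) (Fin m) (EvenForm m)) + A + B := by
    ext k l : 1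
    rw [Matrix.add_apply, Matrix.add_apply, hA, hB, Matrix.of_apply, Matrix.of_apply, hβdz, hae]
    simp only [curvatureForm, Matrix.of_apply, Matrix.smul_apply, hR, smul_eq_mul, hform, w,
      sub_smul, add_smul, Finset.sum_add_distrib, Finset.sum_sub_distrib, smul_sub, smul_add]
    rw [sub_eq_add_neg]
    congr 2
    · rcases eq_or_ne k l with rfl | hkl
      · rw [Matrix.one_apply_eq, mul_one]
        simp
      · simp [hkl]
    · congr 1
      rw [Finset.sum_eq_single l (fun i _ hi => by simp [hi]) (by simp)]
      simp
  have htA : A.trace = w := by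
    simp only [Matrix.trace, Matrix.diag_apply, hA, Matrix.of_apply, hβdz, w, hform,
      Finset.smul_sum]
  have htB : B.trace = -t := by
    simp only [Matrix.trace, Matrix.diag_apply, hB, Matrix.of_apply, hae, t, hform,
      Finset.sum_neg_distrib, Finset.sum_smul, ← Finset.smul_sum]
    congr 2
    rw [Finset.sum_comm]
    exact Finset.sum_congr rfl fun i _ => Finset.sum_comm
  have hAA : A * A = -w • A := by
    rw [hA, of_wedge_mul_of_wedge, ← htA]; rfl
  have hBB : B * B = t • B := by
    rw [hB, of_wedge_mul_of_wedge]
    change -B.trace • B = _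
    rw [htB, neg_neg]
  have hAB : A * B = 0 := by
    rw [hA, hB, of_wedge_mul_of_wedge]
    -- A symmetric tensor contracted with `dz_i ∧ dz_l`; for `B * A` the same happens with `g E` and
    -- the `dzbar`.
    have : ∑ l, wedge (a l) (dz l) = 0 := by
      have := sum_sum_smul_wedge_eq_zero (fun i j => h i j) hh (dz (m := m))
      simp only [ha, map_neg, LinearMap.neg_apply, map_smul, LinearMap.smul_apply, map_sum,
        LinearMap.sum_apply, Finset.sum_neg_distrib, ← Finset.smul_sum]
      rw [Finset.sum_comm, Finset.sum_congr rfl fun i _ => Finset.sum_congr rfl fun j _ => by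
        rw [hh], this, smul_zero, neg_zero]
    rw [this, neg_zero, zero_smul]
  have hBA : B * A = 0 := by
    rw [hA, hB, of_wedge_mul_of_wedge]
    have : ∑ l, wedge (β l) (e l) = 0 := by
      have := sum_sum_smul_wedge_eq_zero (fun i j => ∑ l, g x l i * E l j)
        (fun i j => by simpa only [mul_comm] using (hE i j).symm) (dzbar (m := m))
      simp only [hβ, he, map_neg, LinearMap.neg_apply, map_smul, LinearMap.smul_apply,
        wedge_sum_smul, Finset.sum_neg_distrib, ← Finset.smul_sum]
      rw [neg_eq_zero]
      refine (congrArg (c • ·) ?_).trans (smul_zero c)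
      rw [← this, Finset.sum_comm]
      refine Finset.sum_congr rfl fun i _ => ?_
      rw [Finset.sum_comm]
      simp only [Finset.sum_smul]
    rw [this, neg_zero, zero_smul]
  have := coeff_det_of_orthogonal hAA hBB hAB hBA htA htB q (by simpa using hq)
  simp only [Fintype.card_fin, ← hΘ] at this
  exact this

/-- The determinant is the characteristic polynomial of `-Θ`, which is monic. -/
theorem chernForm_zero {m : ℕ} (g : (Fin m → ℂ) → Matrix (Fin m) (Fin m) ℂ) (x : Fin m → ℂ) :
    chernForm g 0 x = 1 := by
  nontriviality EvenForm m
  have : ((curvatureForm g x).map Polynomial.C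
    + (Polynomial.X : Polynomial (EvenForm m)) • (1 : Matrix (Fin m) (Fin m) _)).det =
      (-curvatureForm g x).charpoly := by
    rw [Matrix.charpoly]
    congr 1
    ext i j : 2
    by_cases h : i = j
    · simp [Matrix.charmatrix, h]
      ring
    · simp [Matrix.charmatrix, h]
  rw [chernForm, this, Nat.sub_zero]
  have h := (-curvatureForm g x).charpoly_monic.coeff_natDegree
  rwa [Matrix.charpoly_natDegree_eq_dim, Fintype.card_fin] at h

end ChernHypersurface
end

/-! ### Smoothness of holomorphic maps in several variables. -/

noncomputable section
namespace ChernHypersurface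

open Filter Topology Metric MeasureTheory

theorem exists_ball_norm_fderiv_le {E F : Type*} [NormedAddCommGroup E] [NormedSpace ℂ E]
    [NormedAddCommGroup F] [NormedSpace ℂ F] {f : E → F} {U : Set E} (hU : IsOpen U)
    (hf : DifferentiableOn ℂ f U) {x : E} (hx : x ∈ U) :
    ∃ δ > 0, ∃ C : ℝ, ball x δ ⊆ U ∧ ∀ y ∈ ball x δ, ‖fderiv ℂ f y‖ ≤ C := by
  have hc : ContinuousAt f x := (hf.continuousOn).continuousAt (hU.mem_nhds hx)
  obtain ⟨δ, hδ, h⟩ := Metric.mem_nhds_iff.1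
    (Filter.inter_mem (hU.mem_nhds hx) (hc (ball_mem_nhds (f x) (show (0 : ℝ) < 1 by norm_num))))
  -- Cauchy's estimate on a ball of radius `δ / 2`, where `f` stays within distance `2` of its value
  -- at the centre.
  refine ⟨δ / 2, by positivity, 2 / (δ / 2), fun y hy => (h (ball_subset_ball (by linarith) hy)).1,
    fun y hy => ?_⟩
  have hsub : ball y (δ / 2) ⊆ ball x δ := by
    apply ball_subset_ball'
    have := mem_ball.1 hy
    linarith
  apply Complex.norm_fderiv_le_div_of_mapsTo_ball (hf.mono fun z hz => (h (hsub hz)).1) _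
    (by positivity)
  intro z hz
  have h1 : dist (f z) (f x) < 1 := (h (hsub hz)).2
  have h2 : dist (f y) (f x) < 1 := (h (hsub (mem_ball_self (by positivity)))).2
  have := dist_triangle_right (f z) (f y) (f x)
  rw [mem_closedBall]; linarith

/-- Cauchy's formula on a small circle in the complex line through `y` in direction `v` expresses
the derivative as an integral of values of `f`, which can be differentiated in `y` under the
integral sign. -/
theorem differentiableOn_fderiv_apply {E F : Type*} [NormedAddCommGroup E] [NormedSpace ℂ E]
    [FiniteDimensional ℂ E] [NormedAddCommGroup F] [NormedSpace ℂ F] [FiniteDimensional ℂ F]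
    {f : E → F} {U : Set E} (hU : IsOpen U) (hf : DifferentiableOn ℂ f U) (v : E) :
    DifferentiableOn ℂ (fun y => fderiv ℂ f y v) U := by
  intro x hx
  apply DifferentiableAt.differentiableWithinAt
  obtain ⟨δ, hδ, C, hsub, hC⟩ := exists_ball_norm_fderiv_le hU hf hx
  have hFc : CompleteSpace F := FiniteDimensional.complete ℂ F
  -- Small enough that circles centred in the half ball stay in `ball x δ`; the `+ 1` covers `v =
  -- 0`.
  set ρ : ℝ := δ / (4 * (‖v‖ + 1)) with hρ
  have hρ0 : 0 < ρ := by positivity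
  have hρv : ρ * ‖v‖ < δ / 2 := by
    rw [hρ, div_mul_eq_mul_div, div_lt_iff₀ (by positivity)]
    nlinarith [norm_nonneg v]
  have hmem : ∀ y ∈ ball x (δ / 2), ∀ ζ ∈ closedBall (0 : ℂ) ρ, y + ζ • v ∈ ball x δ := by
    intro y hy ζ hζ
    rw [mem_ball, dist_eq_norm] at *
    rw [mem_closedBall, dist_zero_right] at hζ
    calc ‖y + ζ • v - x‖ = ‖(y - x) + ζ • v‖ := by congr 1; abel
      _ ≤ ‖y - x‖ + ‖ζ • v‖ := norm_add_le _ _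
      _ < δ / 2 + δ / 2 := by
        have : ‖ζ • v‖ ≤ ρ * ‖v‖ := by rw [norm_smul]; gcongr
        linarith
      _ = δ := by ring
  have hdiff : ∀ y ∈ ball x δ, DifferentiableAt ℂ f y := fun y hy =>
    hf.differentiableAt (hU.mem_nhds (hsub hy))
  have key : ∀ y ∈ ball x (δ / 2), fderiv ℂ f y v =
      (2 * Real.pi * Complex.I : ℂ)⁻¹ • ∮ ζ in C(0, ρ), (1 / (ζ - 0) ^ 2) • f (y + ζ • v) := by
    intro y hy
    have hd : DifferentiableOn ℂ (fun ζ : ℂ => f (y + ζ • v)) (closedBall 0 ρ) := by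
      intro ζ hζ
      apply DifferentiableAt.differentiableWithinAt
      exact (hdiff _ (hmem y hy ζ hζ)).comp ζ (by fun_prop)
    have hder : HasDerivAt (fun ζ : ℂ => f (y + ζ • v)) (fderiv ℂ f y v) 0 := by
      have h1 : HasDerivAt (fun ζ : ℂ => y + ζ • v) v 0 := by
        simpa using ((hasDerivAt_id (0 : ℂ)).smul_const v).const_add y
      have h2 : HasFDerivAt f (fderiv ℂ f y) (y + (0 : ℂ) • v) := by
        simpa using (hdiff y (ball_subset_ball (by linarith) hy)).hasFDerivAt
      exact h2.comp_hasDerivAt (0 : ℂ) h1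
    rw [hd.deriv_eq_smul_circleIntegral hρ0, hder.deriv, smul_smul, inv_mul_cancel₀, one_smul]
    exact Complex.two_pi_I_ne_zero
  have hev : (fun y => fderiv ℂ f y v) =ᶠ[𝓝 x] fun y =>
      (2 * Real.pi * Complex.I : ℂ)⁻¹ • ∮ ζ in C(0, ρ), (1 / (ζ - 0) ^ 2) • f (y + ζ • v) := by
    filter_upwards [ball_mem_nhds x (half_pos hδ)] with y hy using key y hy
  refine DifferentiableAt.congr_of_eventuallyEq ?_ hev
  apply DifferentiableAt.const_smul
  simp only [circleIntegral, intervalIntegral.integral_of_le Real.two_pi_pos.le]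
  borelize E
  have : ProperSpace E := FiniteDimensional.proper ℂ E
  have : ProperSpace F := FiniteDimensional.proper ℂ F
  have hcirc : ∀ θ, circleMap 0 ρ θ ∈ closedBall (0 : ℂ) ρ := fun θ =>
    circleMap_mem_closedBall 0 hρ0.le θ
  have hne : ∀ θ, circleMap 0 ρ θ - 0 ≠ 0 := fun θ => by
    rw [sub_zero]; exact circleMap_ne_center hρ0.ne'
  have hw : Continuous fun θ => deriv (circleMap 0 ρ) θ := by
    simp only [deriv_circleMap]; fun_prop
  have hw2 : Continuous fun θ => 1 / (circleMap 0 ρ θ - 0) ^ 2 :=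
    continuous_const.div (by fun_prop) fun θ => pow_ne_zero 2 (hne θ)
  have hcont : ∀ y ∈ ball x (δ / 2), Continuous fun θ =>
      deriv (circleMap 0 ρ) θ • (1 / (circleMap 0 ρ θ - 0) ^ 2) • f (y + circleMap 0 ρ θ • v) := by
    intro y hy
    refine hw.smul (hw2.smul ?_)
    rw [continuous_iff_continuousAt]
    intro θ
    exact ContinuousAt.comp (f := fun θ => y + circleMap 0 ρ θ • v)
      (hdiff _ (hmem y hy _ (hcirc θ))).continuousAt (by fun_prop)
  refine (hasFDerivAt_integral_of_dominated_of_fderiv_le (𝕜 := ℂ)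
    (F' := fun y θ => deriv (circleMap 0 ρ) θ • (1 / (circleMap 0 ρ θ - 0) ^ 2) •
      fderiv ℂ f (y + circleMap 0 ρ θ • v))
    (bound := fun _ => ρ * (1 / ρ ^ 2 * C))
    (ball_mem_nhds x (half_pos hδ)) ?_ ?_ ?_ ?_ ?_ ?_).differentiableAt
  · filter_upwards [ball_mem_nhds x (half_pos hδ)] with y hy
    exact (hcont y hy).aestronglyMeasurable
  · exact ((hcont x (mem_ball_self (half_pos hδ))).intervalIntegrable 0 (2 * Real.pi)).1
  -- Continuity of `fderiv ℂ f` is not known at this stage, but measurability is enough.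
  · have h1 : Measurable fun θ => fderiv ℂ f (x + circleMap 0 ρ θ • v) :=
      (measurable_fderiv ℂ f).comp
        (by fun_prop : Continuous fun θ => x + circleMap 0 ρ θ • v).measurable
    exact hw.aestronglyMeasurable.smul
      (hw2.aestronglyMeasurable.smul h1.aestronglyMeasurable)
  · refine Eventually.of_forall fun θ y hy => ?_
    rw [norm_smul, norm_smul, norm_div, norm_pow, norm_one, deriv_circleMap, norm_mul,
      Complex.norm_I, mul_one, sub_zero, norm_circleMap_zero, abs_of_pos hρ0]
    gcongr
    exact hC _ (hmem y hy _ (hcirc θ))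
  · exact integrable_const _
  · refine Eventually.of_forall fun θ y hy => ?_
    refine HasFDerivAt.const_smul (HasFDerivAt.const_smul ?_ _) _
    exact (hasFDerivAt_comp_add_right _).2 (hdiff _ (hmem y hy _ (hcirc θ))).hasFDerivAt

theorem contDiffOn_of_differentiableOn {E F : Type*} [NormedAddCommGroup E] [NormedSpace ℂ E]
    [FiniteDimensional ℂ E] [NormedAddCommGroup F] [NormedSpace ℂ F] [FiniteDimensional ℂ F]
    {U : Set E} (hU : IsOpen U) (k : ℕ) {f : E → F} (hf : DifferentiableOn ℂ f U) :
    ContDiffOn ℂ k f U := by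
  induction k generalizing f with
  | zero => exact contDiffOn_zero.2 hf.continuousOn
  | succ k ih =>
    rw [Nat.cast_succ, contDiffOn_succ_iff_fderiv_of_isOpen hU]
    refine ⟨hf, by simp, ?_⟩
    rw [contDiffOn_clm_apply]
    exact fun v => ih (differentiableOn_fderiv_apply hU hf v)

end ChernHypersurface
end

/-! ### Wirtinger calculus and derivatives of the Fubini-Study form. -/

noncomputable section
namespace ChernHypersurface

open Filter Topology Matrix

/-- `u` is real differentiable at `x`, with `∂u/∂z_i = p i` and `∂u/∂\bar z_i = q i` there. -/
structure HasWirtinger {m : ℕ} (u : (Fin m → ℂ) → ℂ) (p q : Fin m → ℂ) (x : Fin m → ℂ) : Prop where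
  diff : DifferentiableAt ℝ u x
  left : ∀ i, wirtinger i u x = p i
  right : ∀ i, wirtingerBar i u x = q i

namespace HasWirtinger

variable {m : ℕ} {u v : (Fin m → ℂ) → ℂ} {p q p' q' : Fin m → ℂ} {x : Fin m → ℂ}

theorem of_differentiableAt (h : DifferentiableAt ℝ u x) :
    HasWirtinger u (fun i => wirtinger i u x) (fun i => wirtingerBar i u x) x :=
  ⟨h, fun _ => rfl, fun _ => rfl⟩

theorem congr_of_eventuallyEq (h : HasWirtinger u p q x) (e : v =ᶠ[𝓝 x] u) :
    HasWirtinger v p q x :=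
  ⟨h.diff.congr_of_eventuallyEq e, fun i => by rw [← h.left, wirtinger, wirtinger, e.fderiv_eq],
    fun i => by rw [← h.right, wirtingerBar, wirtingerBar, e.fderiv_eq]⟩

theorem unique (h : HasWirtinger u p q x) (h' : HasWirtinger u p' q' x) : p = p' ∧ q = q' :=
  ⟨funext fun i => by rw [← h.left, h'.left], funext fun i => by rw [← h.right, h'.right]⟩

theorem const (c : ℂ) : HasWirtinger (fun _ => c) 0 0 x :=
  ⟨differentiableAt_const c, fun i => by simp [wirtinger], fun i => by simp [wirtingerBar]⟩

theorem add (hu : HasWirtinger u p q x) (hv : HasWirtinger v p' q' x) :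
    HasWirtinger (fun y => u y + v y) (p + p') (q + q') x := by
  refine ⟨hu.diff.add hv.diff, fun i => ?_, fun i => ?_⟩
  · rw [Pi.add_apply, ← hu.left, ← hv.left]
    simp only [wirtinger, fderiv_fun_add hu.diff hv.diff, _root_.add_apply]
    ring
  · rw [Pi.add_apply, ← hu.right, ← hv.right]
    simp only [wirtingerBar, fderiv_fun_add hu.diff hv.diff, _root_.add_apply]
    ring

theorem mul (hu : HasWirtinger u p q x) (hv : HasWirtinger v p' q' x) :
    HasWirtinger (fun y => u y * v y) (fun i => p i * v x + u x * p' i)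
      (fun i => q i * v x + u x * q' i) x := by
  refine ⟨hu.diff.mul hv.diff, fun i => ?_, fun i => ?_⟩
  · rw [← hu.left, ← hv.left]
    simp only [wirtinger, fderiv_fun_mul hu.diff hv.diff, _root_.add_apply,
      _root_.smul_apply, smul_eq_mul]
    ring
  · rw [← hu.right, ← hv.right]
    simp only [wirtingerBar, fderiv_fun_mul hu.diff hv.diff, _root_.add_apply,
      _root_.smul_apply, smul_eq_mul]
    ring

theorem const_mul (c : ℂ) (hu : HasWirtinger u p q x) :
    HasWirtinger (fun y => c * u y) (c • p) (c • q) x := by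
  convert (const c).mul hu using 1 <;> ext i <;> simp

theorem sub (hu : HasWirtinger u p q x) (hv : HasWirtinger v p' q' x) :
    HasWirtinger (fun y => u y - v y) (p - p') (q - q') x := by
  simpa [sub_eq_add_neg] using hu.add (hv.const_mul (-1))

theorem sum {ι : Type*} (s : Finset ι) {u : ι → (Fin m → ℂ) → ℂ} {p q : ι → Fin m → ℂ}
    (h : ∀ a ∈ s, HasWirtinger (u a) (p a) (q a) x) :
    HasWirtinger (fun y => ∑ a ∈ s, u a y) (∑ a ∈ s, p a) (∑ a ∈ s, q a) x := by
  classical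
  induction s using Finset.induction_on with
  | empty => simpa using const 0
  | insert a s ha ih =>
    simp only [Finset.sum_insert ha]
    exact (h a (Finset.mem_insert_self a s)).add
      (ih fun b hb => h b (Finset.mem_insert_of_mem hb))

theorem inv (hu : HasWirtinger u p q x) (h0 : u x ≠ 0) :
    HasWirtinger (fun y => (u y)⁻¹) (fun i => -p i / u x ^ 2) (fun i => -q i / u x ^ 2) x := by
  have hd : HasFDerivAt (fun y => (u y)⁻¹) (-(u x ^ 2)⁻¹ • fderiv ℝ u x) x :=
    (hasDerivAt_inv h0).comp_hasFDerivAt_of_eq x hu.diff.hasFDerivAt rfl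
  refine ⟨hd.differentiableAt, fun i => ?_, fun i => ?_⟩
  · rw [← hu.left]
    simp only [wirtinger, hd.fderiv, _root_.smul_apply, smul_eq_mul]
    ring
  · rw [← hu.right]
    simp only [wirtingerBar, hd.fderiv, _root_.smul_apply, smul_eq_mul]
    ring

theorem div (hu : HasWirtinger u p q x) (hv : HasWirtinger v p' q' x) (h0 : v x ≠ 0) :
    HasWirtinger (fun y => u y / v y) (fun i => (p i * v x - u x * p' i) / v x ^ 2)
      (fun i => (q i * v x - u x * q' i) / v x ^ 2) x := by
  simp only [div_eq_mul_inv (u _) (v _)]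
  convert hu.mul (hv.inv h0) using 2 <;> field_simp <;> ring

theorem log {ρ : (Fin m → ℂ) → ℝ} (hu : HasWirtinger (fun y => (ρ y : ℂ)) p q x) (h0 : ρ x ≠ 0) :
    HasWirtinger (fun y => (Real.log (ρ y) : ℂ)) (fun i => p i / ρ x) (fun i => q i / ρ x) x := by
  have hρ : DifferentiableAt ℝ ρ x := by
    have := Complex.reCLM.differentiableAt.comp x hu.diff
    exact this
  have h1 : HasFDerivAt (fun y => (ρ y : ℂ)) (Complex.ofRealCLM.comp (fderiv ℝ ρ x)) x :=
    Complex.ofRealCLM.hasFDerivAt.comp x hρ.hasFDerivAt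
  have h2 : HasFDerivAt (fun y => (Real.log (ρ y) : ℂ))
      (Complex.ofRealCLM.comp ((ρ x)⁻¹ • fderiv ℝ ρ x)) x :=
    Complex.ofRealCLM.hasFDerivAt.comp x (hρ.hasFDerivAt.log h0)
  refine ⟨h2.differentiableAt, fun i => ?_, fun i => ?_⟩
  · rw [← hu.left]
    simp only [wirtinger, h1.fderiv, h2.fderiv, ContinuousLinearMap.comp_apply,
      _root_.smul_apply, smul_eq_mul, Complex.ofRealCLM_apply, Complex.ofReal_mul,
      Complex.ofReal_inv]
    ring
  · rw [← hu.right]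
    simp only [wirtingerBar, h1.fderiv, h2.fderiv, ContinuousLinearMap.comp_apply,
      _root_.smul_apply, smul_eq_mul, Complex.ofRealCLM_apply, Complex.ofReal_mul,
      Complex.ofReal_inv]
    ring

theorem conj (hu : HasWirtinger u p q x) :
    HasWirtinger (fun y => star (u y)) (star q) (star p) x := by
  have h : HasFDerivAt (fun y => star (u y))
      ((Complex.conjCLE : ℂ →L[ℝ] ℂ).comp (fderiv ℝ u x)) x :=
    Complex.conjCLE.hasFDerivAt.comp x hu.diff.hasFDerivAt
  refine ⟨h.differentiableAt, fun i => ?_, fun i => ?_⟩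
  · rw [Pi.star_apply, ← hu.right, wirtinger, h.fderiv]
    simp [wirtingerBar]
    ring
  · rw [Pi.star_apply, ← hu.left, wirtingerBar, h.fderiv]
    simp [wirtinger]

theorem of_holomorphic (hu : DifferentiableAt ℂ u x) :
    HasWirtinger u (fun i => fderiv ℂ u x (Pi.single i 1)) 0 x := by
  have h : HasFDerivAt u ((fderiv ℂ u x).restrictScalars ℝ) x :=
    hu.hasFDerivAt.restrictScalars ℝ
  have hI : ∀ i : Fin m, fderiv ℂ u x (Pi.single i Complex.I) =
      Complex.I * fderiv ℂ u x (Pi.single i 1) := by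
    intro i
    rw [← smul_eq_mul, ← map_smul, ← Pi.single_smul, smul_eq_mul, mul_one]
  refine ⟨h.differentiableAt, fun i => ?_, fun i => ?_⟩
  · rw [wirtinger, h.fderiv, ContinuousLinearMap.coe_restrictScalars', hI, ← mul_assoc,
      Complex.I_mul_I]
    ring
  · rw [wirtingerBar, h.fderiv, ContinuousLinearMap.coe_restrictScalars', hI, ← mul_assoc,
      Complex.I_mul_I, Pi.zero_apply]
    ring

end HasWirtinger

/-- The partial derivative `∂V/∂z_i` of a holomorphic vector-valued function. -/
def pd {m : ℕ} {E : Type*} [NormedAddCommGroup E] [NormedSpace ℂ E] (i : Fin m)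
    (V : (Fin m → ℂ) → E) (x : Fin m → ℂ) : E :=
  fderiv ℂ V x (Pi.single i 1)

section Pairing

variable {m N : ℕ} {x : Fin m → ℂ} {V U Z : (Fin m → ℂ) → Fin N → ℂ}

theorem pd_apply (hV : DifferentiableAt ℂ V x) (i : Fin m) (a : Fin N) :
    fderiv ℂ (fun y => V y a) x (Pi.single i 1) = pd i V x a := by
  rw [pd, fderiv_pi fun a => differentiableAt_pi.1 hV a]
  rfl

theorem hasWirtinger_dotProduct_star (hV : DifferentiableAt ℂ V x) (hU : DifferentiableAt ℂ U x) :
    HasWirtinger (fun y => V y ⬝ᵥ star (U y)) (fun i => pd i V x ⬝ᵥ star (U x))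
      (fun j => V x ⬝ᵥ star (pd j U x)) x := by
  have h : HasWirtinger (fun y => V y ⬝ᵥ star (U y)) _ _ x := HasWirtinger.sum Finset.univ fun (a : Fin N) _ =>
    (HasWirtinger.of_holomorphic (differentiableAt_pi.1 hV a)).mul
      (HasWirtinger.of_holomorphic (differentiableAt_pi.1 hU a)).conj
  convert h using 1
  · ext i
    simp only [dotProduct, Finset.sum_apply, pd_apply hV]
    simp
  · ext i
    simp only [dotProduct, Finset.sum_apply, Pi.star_apply, pd_apply hU]
    simp

theorem pd_dotProduct (hV : DifferentiableAt ℂ V x) (hU : DifferentiableAt ℂ U x) (i : Fin m) :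
    pd i (fun y => V y ⬝ᵥ U y) x = pd i V x ⬝ᵥ U x + V x ⬝ᵥ pd i U x := by
  have hV' := fun a => differentiableAt_pi.1 hV a
  have hU' := fun a => differentiableAt_pi.1 hU a
  simp only [dotProduct, pd]
  rw [fderiv_fun_sum fun a _ => (hV' a).fun_mul (hU' a)]
  simp only [_root_.sum_apply, ← Finset.sum_add_distrib]
  refine Finset.sum_congr rfl fun a _ => ?_
  rw [fderiv_fun_mul (hV' a) (hU' a)]
  simp only [_root_.add_apply, _root_.smul_apply, smul_eq_mul, pd_apply hV, pd_apply hU]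
  simp only [pd]
  ring

end Pairing

theorem ofReal_sum_norm_sq {N : ℕ} (Z : Fin N → ℂ) :
    ((∑ a, ‖Z a‖ ^ 2 : ℝ) : ℂ) = Z ⬝ᵥ star Z := by
  simp [dotProduct, Complex.mul_conj, Complex.normSq_eq_norm_sq]

theorem dotProduct_star_self_ne_zero {N : ℕ} {Z : Fin N → ℂ} (hZ : Z ≠ 0) : Z ⬝ᵥ star Z ≠ 0 := by
  rw [← ofReal_sum_norm_sq, Complex.ofReal_ne_zero]
  obtain ⟨a, ha⟩ := Function.ne_iff.1 hZ
  exact (Finset.sum_pos' (fun _ _ => by positivity)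
    ⟨a, Finset.mem_univ a, by have := norm_pos_iff.2 ha; positivity⟩).ne'

theorem fubiniStudy_eq {n : ℕ} (Z v w : Fin (n + 1) → ℂ) :
    fubiniStudy Z v w = (v ⬝ᵥ star w) / (Z ⬝ᵥ star Z)
      - (v ⬝ᵥ star Z) * (Z ⬝ᵥ star w) / (Z ⬝ᵥ star Z) ^ 2 := by
  rw [← ofReal_sum_norm_sq]; rfl

section FubiniStudy

variable {m n : ℕ} {x : Fin m → ℂ} {V U Z : (Fin m → ℂ) → Fin (n + 1) → ℂ}

/-- For `V = ∂_i Z` the function is `∂_i log |Z|²`, so its antiholomorphic derivative recovers the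
metric. It supplies both the `∂∂̄ log` formula and the constant-curvature part of the Gauss
equation. -/
theorem hasWirtinger_dotProduct_star_div (hZ : DifferentiableAt ℂ Z x) (hZ0 : Z x ≠ 0)
    (hV : DifferentiableAt ℂ V x) :
    HasWirtinger (fun y => (V y ⬝ᵥ star (Z y)) / (Z y ⬝ᵥ star (Z y)))
      (fun i => (pd i V x ⬝ᵥ star (Z x)) / (Z x ⬝ᵥ star (Z x)) -
        (V x ⬝ᵥ star (Z x)) / (Z x ⬝ᵥ star (Z x)) *
          ((pd i Z x ⬝ᵥ star (Z x)) / (Z x ⬝ᵥ star (Z x))))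
      (fun j => fubiniStudy (Z x) (V x) (pd j Z x)) x := by
  have h0 : Z x ⬝ᵥ star (Z x) ≠ 0 := dotProduct_star_self_ne_zero hZ0
  convert (hasWirtinger_dotProduct_star hV hZ).div (hasWirtinger_dotProduct_star hZ hZ) h0 using 1
  · ext i
    field_simp
  · ext j
    rw [fubiniStudy_eq]
    field_simp

theorem hasWirtinger_fubiniStudy (hZ : DifferentiableAt ℂ Z x) (hZ0 : Z x ≠ 0)
    (hV : DifferentiableAt ℂ V x) (hU : DifferentiableAt ℂ U x) :
    HasWirtinger (fun y => fubiniStudy (Z y) (V y) (U y))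
      (fun i => fubiniStudy (Z x) (pd i V x) (U x) -
        (pd i Z x ⬝ᵥ star (Z x)) / (Z x ⬝ᵥ star (Z x)) *
          fubiniStudy (Z x) (V x) (U x) -
        (V x ⬝ᵥ star (Z x)) / (Z x ⬝ᵥ star (Z x)) *
          fubiniStudy (Z x) (pd i Z x) (U x))
      (fun j => fubiniStudy (Z x) (V x) (pd j U x) -
        (Z x ⬝ᵥ star (pd j Z x)) / (Z x ⬝ᵥ star (Z x)) *
          fubiniStudy (Z x) (V x) (U x) -
        (Z x ⬝ᵥ star (U x)) / (Z x ⬝ᵥ star (Z x)) *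
          fubiniStudy (Z x) (V x) (pd j Z x)) x := by
  have h0 : Z x ⬝ᵥ star (Z x) ≠ 0 := dotProduct_star_self_ne_zero hZ0
  have hr := hasWirtinger_dotProduct_star hZ hZ
  simp only [fubiniStudy_eq]
  have h := ((hasWirtinger_dotProduct_star hV hU).div hr h0).sub
    (((hasWirtinger_dotProduct_star hV hZ).mul (hasWirtinger_dotProduct_star hZ hU)).div
      (hr.mul hr) (mul_ne_zero h0 h0))
  simp only [pow_two]
  convert h using 1
  · ext i
    simp only [Pi.sub_apply]
    field_simp
    ring
  · ext i
    simp only [Pi.sub_apply]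
    field_simp
    ring

end FubiniStudy

end ChernHypersurface
end

/-! ### Hermitian linear algebra of the tangent, radial and normal directions. -/

noncomputable section
namespace ChernHypersurface

open Matrix

section LinearAlgebra

variable {n m : ℕ}

theorem star_dotProduct_star' {N : ℕ} (v w : Fin N → ℂ) : star (v ⬝ᵥ star w) = w ⬝ᵥ star v := by
  rw [← star_dotProduct_star, star_star]

theorem star_dotProduct_star_eq {N : ℕ} (v w : Fin N → ℂ) :
    star v ⬝ᵥ star w = star (v ⬝ᵥ w) := by
  rw [star_dotProduct_star, dotProduct_comm]

theorem star_fubiniStudy (Z v w : Fin (n + 1) → ℂ) :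
    star (fubiniStudy Z v w) = fubiniStudy Z w v := by
  rw [fubiniStudy_eq, fubiniStudy_eq, star_sub, star_div₀, star_div₀, star_mul', star_pow]
  simp only [star_dotProduct_star']
  rw [mul_comm (Z ⬝ᵥ star v)]

theorem fubiniStudy_add (Z v v' w : Fin (n + 1) → ℂ) :
    fubiniStudy Z (v + v') w = fubiniStudy Z v w + fubiniStudy Z v' w := by
  simp only [fubiniStudy_eq, add_dotProduct]
  ring

theorem fubiniStudy_smul (Z : Fin (n + 1) → ℂ) (c : ℂ) (v w : Fin (n + 1) → ℂ) :
    fubiniStudy Z (c • v) w = c * fubiniStudy Z v w := by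
  simp only [fubiniStudy_eq, smul_dotProduct, smul_eq_mul]
  ring

theorem fubiniStudy_sum_smul {ι : Type*} [Fintype ι] (Z : Fin (n + 1) → ℂ) (c : ι → ℂ)
    (v : ι → Fin (n + 1) → ℂ) (w : Fin (n + 1) → ℂ) :
    fubiniStudy Z (∑ i, c i • v i) w = ∑ i, c i * fubiniStudy Z (v i) w := by
  simp only [fubiniStudy_eq, sum_dotProduct, smul_dotProduct, smul_eq_mul, Finset.sum_div,
    Finset.sum_mul, ← Finset.sum_sub_distrib]
  exact Finset.sum_congr rfl fun i _ => by ring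

theorem fubiniStudy_self_left {Z : Fin (n + 1) → ℂ} (hZ : Z ≠ 0) (w : Fin (n + 1) → ℂ) :
    fubiniStudy Z Z w = 0 := by
  have := dotProduct_star_self_ne_zero hZ
  rw [fubiniStudy_eq]
  field_simp
  ring

theorem fubiniStudy_star_left {Z v : Fin (n + 1) → ℂ} (h : v ⬝ᵥ Z = 0) (w : Fin (n + 1) → ℂ) :
    fubiniStudy Z (star v) w = star (v ⬝ᵥ w) / (Z ⬝ᵥ star Z) := by
  rw [fubiniStudy_eq, star_dotProduct_star_eq, star_dotProduct_star_eq, h, star_zero]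
  simp

/-- The equality case of Cauchy-Schwarz: up to the factor `|Z|²`, the form is the squared length of
the component of `v` orthogonal to `Z`. -/
theorem eq_smul_of_fubiniStudy_self_eq_zero {Z v : Fin (n + 1) → ℂ} (hZ : Z ≠ 0)
    (h : fubiniStudy Z v v = 0) : v = ((v ⬝ᵥ star Z) / (Z ⬝ᵥ star Z)) • Z := by
  have h0 := dotProduct_star_self_ne_zero hZ
  by_contra hne
  apply dotProduct_star_self_ne_zero (sub_ne_zero.2 hne)
  have hs : star ((v ⬝ᵥ star Z) / (Z ⬝ᵥ star Z)) = (Z ⬝ᵥ star v) / (Z ⬝ᵥ star Z) := by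
    rw [star_div₀, star_dotProduct_star', star_dotProduct_star']
  have : fubiniStudy Z v v * (Z ⬝ᵥ star Z) = 0 := by rw [h, zero_mul]
  rw [← this, fubiniStudy_eq, star_sub, star_smul, hs]
  simp only [sub_dotProduct, dotProduct_sub, smul_dotProduct, dotProduct_smul, smul_eq_mul]
  field_simp
  ring

variable {Z ν : Fin (m + 2) → ℂ} {e : Fin m → Fin (m + 2) → ℂ}

theorem isUnit_gram (hZ : Z ≠ 0) (he : ∀ (t : Fin m → ℂ) (c : ℂ), ∑ l, t l • e l = c • Z → t = 0) :
    IsUnit (Matrix.of fun i j => fubiniStudy Z (e i) (e j)).det := by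
  rw [isUnit_iff_ne_zero]
  intro h
  obtain ⟨t, ht0, ht⟩ := Matrix.exists_vecMul_eq_zero_iff.2 h
  apply ht0
  refine he t _ (eq_smul_of_fubiniStudy_self_eq_zero hZ ?_)
  have hs : ∀ s, fubiniStudy Z (∑ l, t l • e l) (e s) = 0 := fun s => by
    rw [fubiniStudy_sum_smul]
    exact congrFun ht s
  rw [fubiniStudy_sum_smul]
  refine Finset.sum_eq_zero fun s _ => ?_
  rw [← star_fubiniStudy, hs, star_zero, mul_zero]

/-- The vectors `e l`, `Z` and `star ν` form a basis, by independence and a dimension count. Pairing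
with `ν` isolates the last coordinate; pairing with `e s` under the Fubini-Study form kills `Z` and
`star ν`, so the inverse Gram matrix gives the coordinates along `e`. The radial coordinate `c`
never matters and is left unspecified. -/
theorem exists_decomposition (hZ : Z ≠ 0) (hν : ν ≠ 0) (hνZ : ν ⬝ᵥ Z = 0)
    (hνe : ∀ k, ν ⬝ᵥ e k = 0)
    (he : ∀ (t : Fin m → ℂ) (c : ℂ), ∑ l, t l • e l = c • Z → t = 0) (v : Fin (m + 2) → ℂ) :
    ∃ c : ℂ, v = ∑ l, (∑ s, fubiniStudy Z v (e s) *
        (Matrix.of fun i j => fubiniStudy Z (e i) (e j))⁻¹ s l) • e l + c • Z +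
      ((ν ⬝ᵥ v) / (ν ⬝ᵥ star ν)) • star ν := by
  have hν0 := dotProduct_star_self_ne_zero hν
  let L : ((Fin m → ℂ) × ℂ × ℂ) →ₗ[ℂ] (Fin (m + 2) → ℂ) :=
    { toFun := fun p => ∑ l, p.1 l • e l + p.2.1 • Z + p.2.2 • star ν
      map_add' := fun p q => by
        simp only [Prod.fst_add, Prod.snd_add, Pi.add_apply, add_smul, Finset.sum_add_distrib]
        abel
      map_smul' := fun c p => by
        simp only [Prod.smul_fst, Prod.smul_snd, Pi.smul_apply, smul_add, Finset.smul_sum,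
          smul_smul, smul_eq_mul, RingHom.id_apply] }
  have hL : ∀ p, L p = ∑ l, p.1 l • e l + p.2.1 • Z + p.2.2 • star ν := fun _ => rfl
  have hνL : ∀ p, ν ⬝ᵥ L p = p.2.2 * (ν ⬝ᵥ star ν) := fun p => by
    simp only [hL, dotProduct_add, dotProduct_sum, dotProduct_smul, hνe, hνZ, mul_zero,
      Finset.sum_const_zero, zero_add, smul_eq_mul]
  have hinj : Function.Injective L := by
    rw [← LinearMap.ker_eq_bot, LinearMap.ker_eq_bot']
    intro p hp
    have h3 : p.2.2 = 0 := by
      have := hνL p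
      rw [hp, dotProduct_zero] at this
      exact (mul_eq_zero.1 this.symm).resolve_right hν0
    rw [hL, h3, zero_smul, add_zero] at hp
    have h1 : p.1 = 0 := he p.1 (-p.2.1) (by rw [neg_smul]; exact eq_neg_of_add_eq_zero_left hp)
    have h2 : p.2.1 = 0 := by
      rw [h1] at hp
      simpa [hZ] using hp
    exact Prod.ext h1 (Prod.ext h2 h3)
  have hsurj : Function.Surjective L := by
    rw [← LinearMap.injective_iff_surjective_of_finrank_eq_finrank]
    · exact hinj
    · simp
  obtain ⟨⟨t, c, b⟩, rfl⟩ := hsurj v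
  refine ⟨c, ?_⟩
  rw [hνL, mul_div_assoc, div_self hν0, mul_one]
  conv_lhs => rw [hL]
  congr 2
  have hG := isUnit_gram hZ he
  set G := Matrix.of fun i j => fubiniStudy Z (e i) (e j) with hGdef
  have ht : (fun s => fubiniStudy Z (L (t, c, b)) (e s)) = t ᵥ* G := by
    ext s
    rw [hL, fubiniStudy_add, fubiniStudy_add, fubiniStudy_sum_smul, fubiniStudy_smul,
      fubiniStudy_smul, fubiniStudy_self_left hZ, fubiniStudy_star_left hνZ, hνe]
    simp [Matrix.vecMul, dotProduct, hGdef]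
  have ht' : t = (fun s => fubiniStudy Z (L (t, c, b)) (e s)) ᵥ* G⁻¹ := by
    rw [ht, Matrix.vecMul_vecMul, Matrix.mul_nonsing_inv _ hG, Matrix.vecMul_one]
  exact Finset.sum_congr rfl fun l _ => congrArg (· • e l) (congrFun ht' l)

end LinearAlgebra

end ChernHypersurface
end

/-! ### Normal frames and the Gauss equations. -/

noncomputable section
namespace ChernHypersurface

open Matrix Filter Topology

theorem hasWirtinger_log_sum {m n : ℕ} {V : (Fin m → ℂ) → Fin (n + 1) → ℂ} {x : Fin m → ℂ}
    (hV : DifferentiableAt ℂ V x) (hV0 : V x ≠ 0) :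
    HasWirtinger (fun y => (Real.log (∑ a, ‖V y a‖ ^ 2) : ℂ))
      (fun i => (pd i V x ⬝ᵥ star (V x)) / (V x ⬝ᵥ star (V x)))
      (fun j => (V x ⬝ᵥ star (pd j V x)) / (V x ⬝ᵥ star (V x))) x := by
  have h0 := dotProduct_star_self_ne_zero hV0
  have h := hasWirtinger_dotProduct_star hV hV
  simp only [← ofReal_sum_norm_sq] at h h0 ⊢
  exact h.log (Complex.ofReal_ne_zero.1 h0)

/-- The potential `log |V|²` of the Fubini-Study form pulled back by `[V]`. It is applied to `Z` and
to the Gauss map `N`. -/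
theorem hasWirtinger_wirtingerBar_log_sum {m n : ℕ} {U : Set (Fin m → ℂ)} (hU : IsOpen U)
    {V : (Fin m → ℂ) → Fin (n + 1) → ℂ} (hV : DifferentiableOn ℂ V U) (hV0 : ∀ y ∈ U, V y ≠ 0)
    {x : Fin m → ℂ} (hx : x ∈ U) (j : Fin m) :
    ∃ q, HasWirtinger (wirtingerBar j fun y => (Real.log (∑ a, ‖V y a‖ ^ 2) : ℂ))
      (fun i => fubiniStudy (V x) (pd i V x) (pd j V x)) q x := by
  have hd : DifferentiableAt ℂ V x := hV.differentiableAt (hU.mem_nhds hx)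
  have hdj : DifferentiableAt ℂ (pd j V) x :=
    (differentiableOn_fderiv_apply hU hV _).differentiableAt (hU.mem_nhds hx)
  have h := (hasWirtinger_dotProduct_star_div hd (hV0 x hx) hdj).conj
  have e : (wirtingerBar j fun y => (Real.log (∑ a, ‖V y a‖ ^ 2) : ℂ)) =ᶠ[𝓝 x]
      fun y => star ((pd j V y ⬝ᵥ star (V y)) / (V y ⬝ᵥ star (V y))) := by
    filter_upwards [hU.mem_nhds hx] with y hy
    rw [(hasWirtinger_log_sum (hV.differentiableAt (hU.mem_nhds hy)) (hV0 y hy)).right, star_div₀,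
      star_dotProduct_star', star_dotProduct_star']
  have h' := h.congr_of_eventuallyEq e
  exact ⟨_, h'.diff, fun i => by rw [h'.left, Pi.star_apply, star_fubiniStudy], fun _ => rfl⟩

theorem differentiableAt_det {m : ℕ} {E : Type*} [NormedAddCommGroup E] [NormedSpace ℝ E]
    {M : E → Matrix (Fin m) (Fin m) ℂ} {x : E} (h : ∀ i j, DifferentiableAt ℝ (fun y => M y i j) x) :
    DifferentiableAt ℝ (fun y => (M y).det) x := by
  simp only [Matrix.det_apply']
  refine DifferentiableAt.fun_sum fun σ _ => DifferentiableAt.const_mul ?_ _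
  induction (Finset.univ : Finset (Fin m)) using Finset.induction_on with
  | empty => simp
  | insert a s ha ih =>
    simp only [Finset.prod_insert ha]
    exact (h _ _).mul ih

theorem differentiableAt_inv_apply {m : ℕ} {E : Type*} [NormedAddCommGroup E] [NormedSpace ℝ E]
    {M : E → Matrix (Fin m) (Fin m) ℂ} {x : E} (h : ∀ i j, DifferentiableAt ℝ (fun y => M y i j) x)
    (h0 : IsUnit (M x).det) (s l : Fin m) : DifferentiableAt ℝ (fun y => (M y)⁻¹ s l) x := by
  simp only [Matrix.inv_def, Ring.inverse_eq_inv', Matrix.smul_apply, smul_eq_mul,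
    Matrix.adjugate_apply]
  refine ((differentiableAt_det h).inv h0.ne_zero).mul (differentiableAt_det fun i j => ?_)
  simp only [Matrix.updateRow_apply]
  split_ifs
  · exact differentiableAt_const _
  · exact h i j

/-- Homogeneous coordinates `Z` of a local parametrization by an open set `U` of a hypersurface in
projective space, with a normal field `N`, holomorphic in the coordinates. -/
structure NormalFrame (m : ℕ) where
  U : Set (Fin m → ℂ)
  isOpen : IsOpen U
  Z : (Fin m → ℂ) → Fin (m + 2) → ℂ
  N : (Fin m → ℂ) → Fin (m + 2) → ℂ
  diff_Z : DifferentiableOn ℂ Z U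
  diff_N : DifferentiableOn ℂ N U
  Z_ne : ∀ y ∈ U, Z y ≠ 0
  N_ne : ∀ y ∈ U, N y ≠ 0
  N_Z : ∀ y ∈ U, N y ⬝ᵥ Z y = 0
  N_pd : ∀ y ∈ U, ∀ k, N y ⬝ᵥ pd k Z y = 0
  immersive : ∀ y ∈ U, ∀ (t : Fin m → ℂ) (c : ℂ), ∑ l, t l • pd l Z y = c • Z y → t = 0

namespace NormalFrame

variable {m : ℕ} (D : NormalFrame m)

/-- The restricted Fubini-Study metric. -/
def metric (y : Fin m → ℂ) : Matrix (Fin m) (Fin m) ℂ :=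
  Matrix.of fun i j => fubiniStudy (D.Z y) (pd i D.Z y) (pd j D.Z y)

/-- The second fundamental form. -/
def secondForm (y : Fin m → ℂ) : Matrix (Fin m) (Fin m) ℂ :=
  Matrix.of fun k i => D.N y ⬝ᵥ pd i (pd k D.Z) y

/-- The adjoint of the second fundamental form. -/
def shape (y : Fin m → ℂ) : Matrix (Fin m) (Fin m) ℂ :=
  Matrix.of fun l j => (∑ s, star (D.secondForm y s j) * (D.metric y)⁻¹ s l) /
    ((D.N y ⬝ᵥ star (D.N y)) * (D.Z y ⬝ᵥ star (D.Z y)))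

variable {D} {y x : Fin m → ℂ}

theorem isUnit_metric (hy : y ∈ D.U) : IsUnit (D.metric y).det :=
  isUnit_gram (D.Z_ne y hy) (D.immersive y hy)

theorem differentiableOn_pd (k : Fin m) : DifferentiableOn ℂ (pd k D.Z) D.U :=
  differentiableOn_fderiv_apply D.isOpen D.diff_Z _

theorem differentiableOn_pd_pd (i k : Fin m) : DifferentiableOn ℂ (pd i (pd k D.Z)) D.U :=
  differentiableOn_fderiv_apply D.isOpen (differentiableOn_pd k) _

theorem pd_pd_comm (hy : y ∈ D.U) (i k : Fin m) : pd i (pd k D.Z) y = pd k (pd i D.Z) y := by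
  have hc : ContDiffAt ℂ 2 D.Z y :=
    (contDiffOn_of_differentiableOn D.isOpen 2 D.diff_Z).contDiffAt (D.isOpen.mem_nhds hy)
  have hs : IsSymmSndFDerivAt ℂ D.Z y := hc.isSymmSndFDerivAt (by simp)
  have hd : DifferentiableAt ℂ (fderiv ℂ D.Z) y :=
    (hc.fderiv_right (m := 1) (by norm_num)).differentiableAt (by norm_num)
  have : ∀ i k : Fin m, pd i (pd k D.Z) y =
      fderiv ℂ (fderiv ℂ D.Z) y (Pi.single i 1) (Pi.single k 1) := by
    intro i k
    unfold pd
    rw [fderiv_clm_apply hd (differentiableAt_const _)]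
    simp
  rw [this, this, hs.eq]

theorem secondForm_symm (hy : y ∈ D.U) (i k : Fin m) : D.secondForm y i k = D.secondForm y k i := by
  simp only [secondForm, Matrix.of_apply, pd_pd_comm hy]

theorem diffAt_Z (hy : y ∈ D.U) : DifferentiableAt ℂ D.Z y :=
  D.diff_Z.differentiableAt (D.isOpen.mem_nhds hy)

theorem diffAt_N (hy : y ∈ D.U) : DifferentiableAt ℂ D.N y :=
  D.diff_N.differentiableAt (D.isOpen.mem_nhds hy)

theorem diffAt_pd (hy : y ∈ D.U) (k : Fin m) : DifferentiableAt ℂ (pd k D.Z) y :=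
  (differentiableOn_pd k).differentiableAt (D.isOpen.mem_nhds hy)

theorem diffAt_pd_pd (hy : y ∈ D.U) (i k : Fin m) : DifferentiableAt ℂ (pd i (pd k D.Z)) y :=
  (differentiableOn_pd_pd i k).differentiableAt (D.isOpen.mem_nhds hy)

theorem pd_congr {E : Type*} [NormedAddCommGroup E] [NormedSpace ℂ E] {u v : (Fin m → ℂ) → E}
    (h : u =ᶠ[𝓝 y] v) (i : Fin m) : pd i u y = pd i v y := by
  rw [pd, pd, h.fderiv_eq]

theorem pd_N_dotProduct_Z (hy : y ∈ D.U) (i : Fin m) : pd i D.N y ⬝ᵥ D.Z y = 0 := by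
  have h := pd_dotProduct (diffAt_N hy) (diffAt_Z hy) i
  have h0 : (fun y => D.N y ⬝ᵥ D.Z y) =ᶠ[𝓝 y] fun _ => 0 := by
    filter_upwards [D.isOpen.mem_nhds hy] with z hz using D.N_Z z hz
  rw [pd_congr h0, D.N_pd y hy, add_zero] at h
  rw [← h, pd]
  simp

theorem pd_N_dotProduct_pd (hy : y ∈ D.U) (i k : Fin m) :
    pd i D.N y ⬝ᵥ pd k D.Z y = -D.secondForm y k i := by
  have h := pd_dotProduct (diffAt_N hy) (diffAt_pd hy k) i
  have h0 : (fun y => D.N y ⬝ᵥ pd k D.Z y) =ᶠ[𝓝 y] fun _ => 0 := by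
    filter_upwards [D.isOpen.mem_nhds hy] with z hz using D.N_pd z hz k
  rw [pd_congr h0, pd] at h
  simp only [hasFDerivAt_const (0 : ℂ) y |>.fderiv, _root_.zero_apply] at h
  exact eq_neg_of_add_eq_zero_left h.symm

theorem decomposition (hy : y ∈ D.U) (v : Fin (m + 2) → ℂ) :
    ∃ c : ℂ, v = ∑ l, (∑ s, fubiniStudy (D.Z y) v (pd s D.Z y) * (D.metric y)⁻¹ s l) • pd l D.Z y +
      c • D.Z y + ((D.N y ⬝ᵥ v) / (D.N y ⬝ᵥ star (D.N y))) • star (D.N y) :=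
  exists_decomposition (D.Z_ne y hy) (D.N_ne y hy) (D.N_Z y hy) (D.N_pd y hy) (D.immersive y hy) v

/-- The Gauss equation for the normal bundle. -/
theorem fubiniStudy_N (hy : y ∈ D.U) (i j : Fin m) :
    fubiniStudy (D.N y) (pd i D.N y) (pd j D.N y) =
      ∑ l, D.secondForm y l i * D.shape y l j := by
  -- The normal component of this vector gives the subtracted term of `fubiniStudy_eq`, the
  -- tangential one gives `h E`, and the radial one is annihilated by `pd i D.N y`.
  obtain ⟨c, hc⟩ := decomposition hy (star (pd j D.N y))
  have hN := dotProduct_star_self_ne_zero (D.N_ne y hy)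
  have hZ := dotProduct_star_self_ne_zero (D.Z_ne y hy)
  have hdot := congrArg (pd i D.N y ⬝ᵥ ·) hc
  simp only [dotProduct_add, dotProduct_sum, dotProduct_smul, pd_N_dotProduct_Z hy,
    pd_N_dotProduct_pd hy, fubiniStudy_star_left (pd_N_dotProduct_Z hy _), smul_eq_mul,
    mul_zero, add_zero, star_neg] at hdot
  rw [fubiniStudy_eq, hdot]
  have : ∑ l, D.secondForm y l i * D.shape y l j =
      (∑ l, (∑ s, -star (D.secondForm y s j) / (D.Z y ⬝ᵥ star (D.Z y)) * (D.metric y)⁻¹ s l) *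
        -D.secondForm y l i) / (D.N y ⬝ᵥ star (D.N y)) := by
    rw [Finset.sum_div]
    refine Finset.sum_congr rfl fun l _ => ?_
    simp only [shape, Matrix.of_apply, Finset.mul_sum, Finset.sum_mul, Finset.sum_div]
    refine Finset.sum_congr rfl fun s _ => ?_
    field_simp
  rw [this]
  field_simp
  ring

/-- Lowering the index of the adjoint returns the conjugate of `h`; the symmetry needed for `B * A =
0` is read off from this. -/
theorem sum_shape_mul_metric (hy : y ∈ D.U) (j p : Fin m) :
    ∑ l, D.shape y l j * D.metric y l p = star (D.secondForm y p j) /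
      ((D.N y ⬝ᵥ star (D.N y)) * (D.Z y ⬝ᵥ star (D.Z y))) := by
  have h := congrFun (congrArg ((fun s => star (D.secondForm y s j)) ᵥ* ·)
    (Matrix.nonsing_inv_mul _ (isUnit_metric hy))) p
  simp only [← Matrix.vecMul_vecMul, Matrix.vecMul_one] at h
  rw [← h]
  simp only [Matrix.vecMul, dotProduct, shape, Matrix.of_apply, Finset.sum_div]
  refine Finset.sum_congr rfl fun l _ => ?_
  rw [← Finset.sum_div]
  ring

theorem hasWirtinger_metric (hy : y ∈ D.U) (k s : Fin m) :
    HasWirtinger (fun y => D.metric y k s)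
      (fun i => fubiniStudy (D.Z y) (pd i (pd k D.Z) y) (pd s D.Z y) -
        (pd i D.Z y ⬝ᵥ star (D.Z y)) / (D.Z y ⬝ᵥ star (D.Z y)) * D.metric y k s -
        (pd k D.Z y ⬝ᵥ star (D.Z y)) / (D.Z y ⬝ᵥ star (D.Z y)) * D.metric y i s)
      (fun j => fubiniStudy (D.Z y) (pd k D.Z y) (pd j (pd s D.Z) y) -
        (D.Z y ⬝ᵥ star (pd j D.Z y)) / (D.Z y ⬝ᵥ star (D.Z y)) * D.metric y k s -
        (D.Z y ⬝ᵥ star (pd s D.Z y)) / (D.Z y ⬝ᵥ star (D.Z y)) * D.metric y k j) y :=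
  hasWirtinger_fubiniStudy (diffAt_Z hy) (D.Z_ne y hy) (diffAt_pd hy k) (diffAt_pd hy s)

variable (D) in
/-- The coefficients of the second derivatives of `Z` along its first derivatives. -/
def secondCoeff (i k l : Fin m) (y : Fin m → ℂ) : ℂ :=
  ∑ s, fubiniStudy (D.Z y) (pd i (pd k D.Z) y) (pd s D.Z y) * (D.metric y)⁻¹ s l

theorem sum_secondCoeff_mul_metric (hy : y ∈ D.U) (i k s : Fin m) :
    ∑ l, D.secondCoeff i k l y * D.metric y l s =
      fubiniStudy (D.Z y) (pd i (pd k D.Z) y) (pd s D.Z y) := by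
  have h := congrFun (congrArg
    ((fun s => fubiniStudy (D.Z y) (pd i (pd k D.Z) y) (pd s D.Z y)) ᵥ* ·)
    (Matrix.nonsing_inv_mul _ (isUnit_metric hy))) s
  simp only [← Matrix.vecMul_vecMul, Matrix.vecMul_one] at h
  exact h

theorem differentiableAt_secondCoeff (hy : y ∈ D.U) (i k l : Fin m) :
    DifferentiableAt ℝ (D.secondCoeff i k l) y := by
  refine DifferentiableAt.fun_sum fun s _ => ?_
  exact (hasWirtinger_fubiniStudy (diffAt_Z hy) (D.Z_ne y hy) (diffAt_pd_pd hy i k)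
    (diffAt_pd hy s)).diff.mul
    (differentiableAt_inv_apply (fun i j => (hasWirtinger_metric hy i j).diff) (isUnit_metric hy) _ _)

/-- The Christoffel symbols. -/
theorem sum_wirtinger_metric_mul_inv (hy : y ∈ D.U) (i k l : Fin m) :
    ∑ s, wirtinger i (fun w => D.metric w k s) y * (D.metric y)⁻¹ s l =
      D.secondCoeff i k l y -
        (pd i D.Z y ⬝ᵥ star (D.Z y)) / (D.Z y ⬝ᵥ star (D.Z y)) * (if k = l then 1 else 0) -
        (pd k D.Z y ⬝ᵥ star (D.Z y)) / (D.Z y ⬝ᵥ star (D.Z y)) * (if i = l then 1 else 0) := by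
  have h : ∀ k l, ∑ s, D.metric y k s * (D.metric y)⁻¹ s l = if k = l then 1 else 0 := fun k l => by
    rw [← Matrix.one_apply, ← Matrix.mul_nonsing_inv _ (isUnit_metric hy), Matrix.mul_apply]
  simp only [(hasWirtinger_metric hy _ _).left, sub_mul, Finset.sum_sub_distrib, mul_assoc,
    ← Finset.mul_sum, h]
  rfl

/-- The identity `sum_secondCoeff_mul_metric` is differentiated, so no derivative of the inverse
metric has to be computed. Tangential contributions cancel, and what remains is the normal component
of `∂_i ∂_k Z` paired with that of `∂_j ∂_s Z`. -/
theorem wirtingerBar_secondCoeff (hx : x ∈ D.U) (i k l j : Fin m) :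
    wirtingerBar j (D.secondCoeff i k l) x = D.secondForm x k i * D.shape x l j := by
  have hG := isUnit_metric hx
  suffices h : ∀ s, ∑ l, wirtingerBar j (D.secondCoeff i k l) x * D.metric x l s =
      ∑ l, D.secondForm x k i * D.shape x l j * D.metric x l s by
    have h' : (fun l => wirtingerBar j (D.secondCoeff i k l) x) ᵥ* D.metric x =
        (fun l => D.secondForm x k i * D.shape x l j) ᵥ* D.metric x := funext h
    have := congrArg (· ᵥ* (D.metric x)⁻¹) h'
    simp only [Matrix.vecMul_vecMul, Matrix.mul_nonsing_inv _ hG, Matrix.vecMul_one] at this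
    exact congrFun this l
  intro s
  simp only [mul_assoc, ← Finset.mul_sum, sum_shape_mul_metric hx]
  have h1 := HasWirtinger.sum Finset.univ fun (l : Fin m) _ =>
    (HasWirtinger.of_differentiableAt (differentiableAt_secondCoeff hx i k l)).mul
      (hasWirtinger_metric hx l s)
  have h2 := hasWirtinger_fubiniStudy (diffAt_Z hx) (D.Z_ne x hx) (diffAt_pd_pd hx i k)
    (diffAt_pd hx s)
  have e : (fun y => ∑ l, D.secondCoeff i k l y * D.metric y l s) =ᶠ[𝓝 x]
      fun y => fubiniStudy (D.Z y) (pd i (pd k D.Z) y) (pd s D.Z y) := by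
    filter_upwards [D.isOpen.mem_nhds hx] with y hy using sum_secondCoeff_mul_metric hy i k s
  have h3 := congrFun (h1.unique (h2.congr_of_eventuallyEq e)).2 j
  obtain ⟨c, hc⟩ := decomposition hx (pd i (pd k D.Z) x)
  have hc' := congrArg (fun v => fubiniStudy (D.Z x) v (pd j (pd s D.Z) x)) hc
  simp only [fubiniStudy_add, fubiniStudy_smul, fubiniStudy_sum_smul,
    fubiniStudy_self_left (D.Z_ne x hx), fubiniStudy_star_left (D.N_Z x hx), mul_zero,
    add_zero] at hc'
  change _ = ∑ l, D.secondCoeff i k l x * _ + _ at hc'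
  simp only [Finset.sum_apply, Finset.sum_add_distrib, mul_sub, Finset.sum_sub_distrib,
    mul_left_comm (D.secondCoeff i k _ x), ← Finset.mul_sum, sum_secondCoeff_mul_metric hx] at h3
  simp only [secondForm, Matrix.of_apply] at *
  rw [← mul_div_assoc]
  rw [div_mul_div_comm] at hc'
  linear_combination h3 + hc'

/-- The Gauss equation for the tangent bundle. -/
theorem curvatureTensor_metric (hx : x ∈ D.U) (l k i j : Fin m) :
    curvatureTensor D.metric l k i j x =
      (if k = l then D.metric x i j else 0) + (if i = l then D.metric x k j else 0) -
        D.secondForm x k i * D.shape x l j := by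
  have hb : ∀ i, HasWirtinger (fun y => (pd i D.Z y ⬝ᵥ star (D.Z y)) / (D.Z y ⬝ᵥ star (D.Z y)))
      _ (fun j => D.metric x i j) x := fun i =>
    hasWirtinger_dotProduct_star_div (diffAt_Z hx) (D.Z_ne x hx) (diffAt_pd hx i)
  have h := (((HasWirtinger.of_differentiableAt (differentiableAt_secondCoeff hx i k l)).sub
    ((hb i).mul (HasWirtinger.const (if k = l then 1 else 0)))).sub
    ((hb k).mul (HasWirtinger.const (if i = l then 1 else 0))))
  have h' := h.congr_of_eventuallyEq
    (v := fun y => ∑ s, wirtinger i (fun w => D.metric w k s) y * (D.metric y)⁻¹ s l) (by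
      filter_upwards [D.isOpen.mem_nhds hx] with y hy using sum_wirtinger_metric_mul_inv hy i k l)
  rw [curvatureTensor, h'.right]
  simp only [Pi.sub_apply, Pi.zero_apply, mul_zero, add_zero, mul_ite, mul_one,
    wirtingerBar_secondCoeff hx]
  ring

end NormalFrame

end ChernHypersurface
end

/-! ### The normal frame of a hypersurface, `∂∂̄ξ`, and the recursion for the Chern forms. -/

noncomputable section
namespace ChernHypersurface

open Matrix Filter Topology

theorem differentiable_eval {N : ℕ} (F : MvPolynomial (Fin N) ℂ) :
    Differentiable ℂ fun Z : Fin N → ℂ => MvPolynomial.eval Z F := by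
  induction F using MvPolynomial.induction_on with
  | C a => simp
  | add p q hp hq => simp only [map_add]; exact hp.fun_add hq
  | mul_X p i hp =>
    simp only [map_mul, MvPolynomial.eval_X]
    exact hp.fun_mul (differentiable_apply i)

theorem fderiv_eval {N : ℕ} (F : MvPolynomial (Fin N) ℂ) (Z v : Fin N → ℂ) :
    fderiv ℂ (fun Z : Fin N → ℂ => MvPolynomial.eval Z F) Z v =
      (fun a => MvPolynomial.eval Z (MvPolynomial.pderiv a F)) ⬝ᵥ v := by
  induction F using MvPolynomial.induction_on with
  | C a => simp [dotProduct]
  | add p q hp hq =>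
    simp only [map_add]
    rw [fderiv_fun_add (differentiable_eval p Z) (differentiable_eval q Z), _root_.add_apply, hp, hq]
    exact (add_dotProduct _ _ _).symm
  | mul_X p i hp =>
    simp only [map_mul, MvPolynomial.eval_X]
    rw [fderiv_fun_mul (differentiable_eval p Z) (differentiable_apply i Z)]
    have hi : fderiv ℂ (fun Z : Fin N → ℂ => Z i) Z v = v i := by
      rw [(hasFDerivAt_apply i Z).fderiv]; rfl
    simp only [_root_.add_apply, _root_.smul_apply, hp, hi, smul_eq_mul,
      Derivation.leibniz, MvPolynomial.pderiv_X, map_add, map_mul, MvPolynomial.eval_X,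
      dotProduct, add_mul, Finset.sum_add_distrib, Finset.mul_sum]
    congr 1
    · rw [Finset.sum_eq_single i (fun a _ ha => by rw [Pi.single_eq_of_ne ha.symm]; simp) (by simp)]
      simp
    · exact Finset.sum_congr rfl fun a _ => by ring

theorem eval_smul {N d : ℕ} {F : MvPolynomial (Fin N) ℂ} (hF : F.IsHomogeneous d) (c : ℂ)
    (Z : Fin N → ℂ) : MvPolynomial.eval (c • Z) F = c ^ d * MvPolynomial.eval Z F := by
  rw [MvPolynomial.eval_eq', MvPolynomial.eval_eq', Finset.mul_sum]
  refine Finset.sum_congr rfl fun e he => ?_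
  have hdeg : ∑ i, e i = d := by
    rw [← hF (MvPolynomial.mem_support_iff.1 he), Finsupp.weight_apply, Finsupp.sum_fintype]
    · simp
    · simp
  simp only [Pi.smul_apply, smul_eq_mul, mul_pow, Finset.prod_mul_distrib]
  rw [Finset.prod_pow_eq_pow_sum, hdeg]
  ring

theorem ddbar_eq {m : ℕ} {u : (Fin m → ℂ) → ℂ} {x : Fin m → ℂ} {M : Matrix (Fin m) (Fin m) ℂ}
    (h : ∀ i j, wirtinger i (wirtingerBar j u) x = M i j) : ddbar u x = oneOneForm M := by
  rw [ddbar]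
  congr 1
  ext i j
  exact h i j

theorem oneOneForm_add {m : ℕ} (M M' : Matrix (Fin m) (Fin m) ℂ) :
    oneOneForm (M + M') = oneOneForm M + oneOneForm M' := by
  simp only [oneOneForm, Matrix.add_apply, add_smul, Finset.sum_add_distrib, smul_add]

theorem oneOneForm_smul {m : ℕ} (c : ℂ) (M : Matrix (Fin m) (Fin m) ℂ) :
    oneOneForm (c • M) = c • oneOneForm M := by
  simp only [oneOneForm, Matrix.smul_apply, smul_eq_mul, mul_smul, ← Finset.smul_sum]
  rw [smul_comm]

namespace LocalParam

variable {m d : ℕ} {F : MvPolynomial (Fin (m + 1 + 1)) ℂ}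

/-- Homogeneity transfers the vanishing from the chosen representative of the point to the lift. -/
theorem eval_lift (hF : F.IsHomogeneous d) (φ : LocalParam F m) {y : Fin m → ℂ} (hy : y ∈ φ.dom) :
    MvPolynomial.eval (φ.lift y) F = 0 := by
  have h : MvPolynomial.eval (Projectivization.mk ℂ (φ.lift y) (φ.lift_ne_zero y hy)).rep F = 0 :=
    φ.mem_hypersurface y hy
  obtain ⟨a, ha⟩ := Projectivization.exists_smul_eq_mk_rep ℂ (φ.lift y) (φ.lift_ne_zero y hy)
  rw [← ha, Units.smul_def, eval_smul hF] at h
  exact (mul_eq_zero.1 h).resolve_left (pow_ne_zero d a.ne_zero)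

/-- The normal frame given by the gradient of `F`. -/
def normalFrame (hF : F.IsHomogeneous d) (hsmooth : IsNonsingular F) (φ : LocalParam F m) :
    NormalFrame m where
  U := φ.dom
  isOpen := φ.isOpen_dom
  Z := φ.lift
  N := fun y a => MvPolynomial.eval (φ.lift y) (MvPolynomial.pderiv a F)
  diff_Z := φ.holomorphic
  diff_N := by
    rw [differentiableOn_pi]
    exact fun a => (differentiable_eval _).comp_differentiableOn φ.holomorphic
  Z_ne := φ.lift_ne_zero
  N_ne := fun y hy h => by
    obtain ⟨k, hk⟩ := hsmooth _ (φ.lift_ne_zero y hy) (eval_lift hF φ hy)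
    exact hk (congrFun h k)
  N_Z := fun y hy => by
    -- Euler's identity on the zero locus of `F`.
    have h := congrArg (MvPolynomial.eval (φ.lift y)) hF.sum_X_mul_pderiv
    rw [map_nsmul, eval_lift hF φ hy, smul_zero, map_sum] at h
    rw [← h]
    exact Finset.sum_congr rfl fun a _ => by simp [mul_comm]
  N_pd := fun y hy k => by
    have h0 : (fun y => MvPolynomial.eval (φ.lift y) F) =ᶠ[𝓝 y] fun _ => 0 := by
      filter_upwards [φ.isOpen_dom.mem_nhds hy] with z hz using eval_lift hF φ hz
    have h1 := ((differentiable_eval F (φ.lift y)).hasFDerivAt.comp y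
      (φ.holomorphic.differentiableAt (φ.isOpen_dom.mem_nhds hy)).hasFDerivAt).fderiv
    have h2 := congrArg (fun L => L (Pi.single k 1)) (h0.fderiv_eq.symm.trans h1)
    simp only [ContinuousLinearMap.comp_apply, fderiv_eval] at h2
    rw [pd, ← h2]
    simp
  immersive := fun y hy t c h => by
    refine φ.immersive y hy t c ?_
    rw [← h]
    conv_lhs => rw [pi_eq_sum_univ' t]
    simp [pd, map_sum]

theorem normalFrame_metric (hF : F.IsHomogeneous d) (hsmooth : IsNonsingular F)
    (φ : LocalParam F m) : (φ.normalFrame hF hsmooth).metric = φ.metric := rfl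

/-- The `∂∂̄` of `log |N|²` is the pullback of the Fubini-Study form by the Gauss map, computed by
`NormalFrame.fubiniStudy_N`; that of `log |Z|²` is the Kähler form. This identifies `w + t` in
`chernForm_succ_add`. The hypothesis `1 ≤ d` makes the truncated `d - 1` a true difference. -/
theorem ddbar_xi (hd : 1 ≤ d) (hF : F.IsHomogeneous d) (hsmooth : IsNonsingular F)
    (φ : LocalParam F m) {x : Fin m → ℂ} (hx : x ∈ φ.dom) :
    (d : ℂ) • φ.kahlerForm x + ddbar (fun y => (xi F d (φ.lift y) : ℂ)) x =
      φ.kahlerForm x + oneOneForm (Matrix.of fun i j =>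
        ∑ l, (φ.normalFrame hF hsmooth).secondForm x l i *
          (φ.normalFrame hF hsmooth).shape x l j) := by
  set D := φ.normalFrame hF hsmooth with hD
  have hU : ∀ {y}, y ∈ φ.dom → φ.dom ∈ 𝓝 y := fun hy => φ.isOpen_dom.mem_nhds hy
  have hpos : ∀ {N : ℕ} {v : Fin N → ℂ}, v ≠ 0 → ∑ a, ‖v a‖ ^ 2 ≠ 0 := fun hv => by
    have := dotProduct_star_self_ne_zero hv
    rwa [← ofReal_sum_norm_sq, Complex.ofReal_ne_zero] at this
  have hxi : ∀ y ∈ φ.dom, (xi F d (φ.lift y) : ℂ) = (Real.log (∑ a, ‖D.N y a‖ ^ 2) : ℂ) -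
      ((d - 1 : ℕ) : ℂ) * (Real.log (∑ a, ‖D.Z y a‖ ^ 2) : ℂ) := by
    intro y hy
    have hN := hpos (D.N_ne y hy)
    have hZ := hpos (D.Z_ne y hy)
    rw [xi]
    have := Real.log_div hN (pow_ne_zero (d - 1) hZ)
    rw [Real.log_pow] at this
    exact_mod_cast congrArg ((↑) : ℝ → ℂ) this
  have hbar : ∀ j, wirtingerBar j (fun y => (xi F d (φ.lift y) : ℂ)) =ᶠ[𝓝 x] fun y =>
      wirtingerBar j (fun y => (Real.log (∑ a, ‖D.N y a‖ ^ 2) : ℂ)) y - ((d - 1 : ℕ) : ℂ) *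
        wirtingerBar j (fun y => (Real.log (∑ a, ‖D.Z y a‖ ^ 2) : ℂ)) y := by
    intro j
    filter_upwards [hU hx] with y hy
    have hN := hasWirtinger_log_sum (NormalFrame.diffAt_N (D := D) hy) (D.N_ne y hy)
    have hZ := hasWirtinger_log_sum (NormalFrame.diffAt_Z (D := D) hy) (D.Z_ne y hy)
    have := (hN.sub (hZ.const_mul ((d - 1 : ℕ) : ℂ))).congr_of_eventuallyEq
      (v := fun y => (xi F d (φ.lift y) : ℂ)) (by filter_upwards [hU hy] with z hz using hxi z hz)
    rw [this.right, hN.right, hZ.right]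
    rfl
  have hdd : ddbar (fun y => (xi F d (φ.lift y) : ℂ)) x = oneOneForm ((Matrix.of fun i j =>
      ∑ l, D.secondForm x l i * D.shape x l j) + (-((d - 1 : ℕ) : ℂ)) • φ.metric x) := by
    refine ddbar_eq fun i j => ?_
    obtain ⟨q, hN⟩ := hasWirtinger_wirtingerBar_log_sum D.isOpen D.diff_N D.N_ne hx j
    obtain ⟨q', hZ⟩ := hasWirtinger_wirtingerBar_log_sum D.isOpen D.diff_Z D.Z_ne hx j
    rw [((hN.sub (hZ.const_mul ((d - 1 : ℕ) : ℂ))).congr_of_eventuallyEq (hbar j)).left]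
    simp only [Pi.sub_apply, Pi.smul_apply, Matrix.add_apply, Matrix.smul_apply, Matrix.of_apply,
      NormalFrame.fubiniStudy_N (D := D) hx, smul_eq_mul, neg_mul]
    rw [← sub_eq_add_neg]
    rfl
  rw [hdd, oneOneForm_add, oneOneForm_smul, kahlerForm]
  obtain ⟨e, rfl⟩ : ∃ e, d = e + 1 := ⟨d - 1, by omega⟩
  simp only [Nat.add_sub_cancel]
  push_cast
  module

/-- The recursion satisfied by the Chern forms of a projective hypersurface. -/
theorem chernForm_succ (hd : 1 ≤ d) (hF : F.IsHomogeneous d) (hsmooth : IsNonsingular F)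
    (φ : LocalParam F m) {x : Fin m → ℂ} (hx : x ∈ φ.dom) {q : ℕ} (hq : q + 1 ≤ m) :
    chernForm φ.metric (q + 1) x =
      ((m + 2).choose (q + 1) : ℂ) • φ.kahlerForm x ^ (q + 1) -
        ((d : ℂ) • φ.kahlerForm x + ddbar (fun y => (xi F d (φ.lift y) : ℂ)) x) *
          chernForm φ.metric q x := by
  have h := chernForm_succ_add (φ.normalFrame hF hsmooth).metric x _ _
    (NormalFrame.secondForm_symm hx)
    (fun j p => by
      rw [NormalFrame.sum_shape_mul_metric hx, NormalFrame.sum_shape_mul_metric hx,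
        NormalFrame.secondForm_symm hx])
    (NormalFrame.curvatureTensor_metric hx) q hq
  rw [normalFrame_metric] at h
  rw [ddbar_xi hd hF hsmooth φ hx, Nat.cast_smul_eq_nsmul, nsmul_eq_mul]
  exact eq_sub_of_add_eq h

end LocalParam

/-! ### The recursion for the coefficients and its closed form. -/

namespace IsChernCoeff

variable {n d : ℕ} {α : ℕ → ℕ → ℤ}

theorem succ_zero (hα : IsChernCoeff n d α) {q : ℕ} (hq : q + 1 ≤ n - 1) :
    α (q + 1) 0 = -α q 0 := by
  rw [hα.bot (q + 1) (by omega) hq]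
  rcases Nat.eq_zero_or_pos q with rfl | h
  · simp [hα.zero]
  · rw [hα.bot q h (by omega), pow_succ]
    ring

theorem succ_self (hα : IsChernCoeff n d α) {q : ℕ} (hq : q + 1 ≤ n - 1) :
    α (q + 1) (q + 1) = ((n + 1).choose (q + 1) : ℤ) - d * α q q :=
  hα.top (q + 1) (by omega) hq

theorem succ_succ (hα : IsChernCoeff n d α) {q j : ℕ} (hq : q + 1 ≤ n - 1) (hj : j < q) :
    α (q + 1) (j + 1) = -(d * α q j + α q (j + 1)) := by
  have h := hα.mid (q + 1) (by omega) hq (q - j) (by omega) (by omega)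
  rwa [show q + 1 - (q - j) = j + 1 by omega, Nat.add_sub_cancel, Nat.add_sub_cancel] at h

theorem sum_eq (hα : IsChernCoeff n d α) {R : Type*} [CommRing R] [Algebra ℂ R] (w e : R) {q : ℕ}
    (hq : q + 1 ≤ n - 1) :
    ∑ k ∈ Finset.range (q + 1 + 1), (α (q + 1) k : ℂ) • (w ^ k * e ^ (q + 1 - k)) =
      ((n + 1).choose (q + 1) : ℂ) • w ^ (q + 1) - ((d : ℂ) • w + e) *
        ∑ k ∈ Finset.range (q + 1), (α q k : ℂ) • (w ^ k * e ^ (q - k)) := by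
  -- The factor `d w` raises the power of `w`, the factor `e` does not. Splitting off the top term
  -- for the former and the bottom term for the latter aligns the remaining powers.
  have h1 := Finset.sum_range_succ (fun k => (α q k : ℂ) • (w ^ k * e ^ (q - k))) q
  have h2 := Finset.sum_range_succ' (fun k => (α q k : ℂ) • (w ^ k * e ^ (q - k))) q
  rw [add_mul]
  nth_rewrite 1 [h1]
  rw [h2, Finset.sum_range_succ, Finset.sum_range_succ', hα.succ_zero hq, hα.succ_self hq, mul_add,
    mul_add, Finset.mul_sum, Finset.mul_sum]
  have hmid : ∑ k ∈ Finset.range q, (α (q + 1) (k + 1) : ℂ) • (w ^ (k + 1) * e ^ (q + 1 - (k + 1))) =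
      -(∑ k ∈ Finset.range q, ((d : ℂ) • w) * ((α q k : ℂ) • (w ^ k * e ^ (q - k)))) -
        ∑ k ∈ Finset.range q, e * ((α q (k + 1) : ℂ) • (w ^ (k + 1) * e ^ (q - (k + 1)))) := by
    rw [← Finset.sum_neg_distrib, ← Finset.sum_sub_distrib]
    refine Finset.sum_congr rfl fun k hk => ?_
    have hk := Finset.mem_range.1 hk
    rw [hα.succ_succ hq hk, show q + 1 - (k + 1) = q - (k + 1) + 1 by omega,
      show q - k = q - (k + 1) + 1 by omega]
    simp only [Algebra.smul_def]
    push_cast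
    ring
  rw [hmid]
  simp only [Algebra.smul_def, Nat.sub_self, Nat.sub_zero]
  push_cast
  ring

end IsChernCoeff

/-- The coefficients in closed form, up to the sign `(-1) ^ q`. -/
def chernCoeffSum (n d q k : ℕ) : ℤ :=
  ∑ l ∈ Finset.range (k + 1), (-1) ^ l * (d : ℤ) ^ (k - l) * ((q - l).choose (k - l) : ℤ) *
    ((n + 1).choose l : ℤ)

theorem chernCoeffSum_zero (n d q : ℕ) : chernCoeffSum n d q 0 = 1 := by
  simp [chernCoeffSum]

theorem chernCoeffSum_succ_self (n d q : ℕ) :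
    chernCoeffSum n d (q + 1) (q + 1) =
      d * chernCoeffSum n d q q + (-1) ^ (q + 1) * ((n + 1).choose (q + 1) : ℤ) := by
  rw [chernCoeffSum, Finset.sum_range_succ, chernCoeffSum, Finset.mul_sum]
  congr 1
  · refine Finset.sum_congr rfl fun l hl => ?_
    have hl := Finset.mem_range.1 hl
    rw [show q + 1 - l = q - l + 1 by omega, Nat.choose_self, Nat.choose_self]
    ring
  · simp

/-- Pascal's rule term by term; the last term, `l = j + 1`, has binomial factor `1` on both sides
and occurs only in the second sum. -/
theorem chernCoeffSum_succ_succ (n d : ℕ) {q j : ℕ} (hj : j < q) :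
    chernCoeffSum n d (q + 1) (j + 1) =
      d * chernCoeffSum n d q j + chernCoeffSum n d q (j + 1) := by
  simp only [chernCoeffSum]
  rw [Finset.sum_range_succ, Finset.sum_range_succ (n := j + 1), ← add_assoc, Finset.mul_sum,
    ← Finset.sum_add_distrib]
  congr 1
  · refine Finset.sum_congr rfl fun l hl => ?_
    have hl := Finset.mem_range.1 hl
    rw [show q + 1 - l = q - l + 1 by omega, show j + 1 - l = j - l + 1 by omega,
      Nat.choose_succ_succ]
    push_cast
    ring
  · simp

theorem isChernCoeff_iff (n d : ℕ) (α : ℕ → ℕ → ℤ) :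
    IsChernCoeff n d α ↔ ∀ q ≤ n - 1, ∀ k ≤ q, α q k = (-1) ^ q * chernCoeffSum n d q k := by
  constructor
  · intro hα q
    induction q with
    | zero =>
      intro _ k hk
      obtain rfl := Nat.le_zero.1 hk
      simp [hα.zero, chernCoeffSum_zero]
    | succ q ih =>
      intro hq k hk
      have ih := ih (by omega)
      rcases k with _ | j
      · rw [hα.succ_zero hq, ih 0 (Nat.zero_le q), chernCoeffSum_zero, chernCoeffSum_zero]
        ring
      rcases (Nat.le_of_succ_le_succ hk).eq_or_lt with rfl | hj
      · rw [hα.succ_self hq, ih j le_rfl, chernCoeffSum_succ_self, mul_add, ← mul_assoc _ _ (Nat.cast _),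
          ← mul_pow]
        ring
      · rw [hα.succ_succ hq hj, ih j hj.le, ih (j + 1) hj, chernCoeffSum_succ_succ n d hj]
        ring
  · intro h
    refine ⟨?_, ?_, ?_, ?_⟩
    · rw [h 0 (Nat.zero_le _) 0 le_rfl, chernCoeffSum_zero]
      simp
    · intro q hq1 hq
      obtain ⟨q, rfl⟩ : ∃ p, q = p + 1 := ⟨q - 1, by omega⟩
      rw [Nat.add_sub_cancel, h (q + 1) hq _ le_rfl, h q (by omega) q le_rfl,
        chernCoeffSum_succ_self, mul_add, ← mul_assoc _ _ (Nat.cast _), ← mul_pow]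
      ring
    · intro q hq1 hq k hk1 hk
      obtain ⟨q, rfl⟩ : ∃ p, q = p + 1 := ⟨q - 1, by omega⟩
      obtain ⟨j, hj⟩ : ∃ j, q + 1 - k = j + 1 := ⟨q - k, by omega⟩
      rw [hj, Nat.add_sub_cancel, Nat.add_sub_cancel, h (q + 1) hq _ (by omega),
        h q (by omega) j (by omega), h q (by omega) (j + 1) (by omega),
        chernCoeffSum_succ_succ n d (by omega)]
      ring
    · intro q _ hq
      rw [h q hq 0 (Nat.zero_le q), chernCoeffSum_zero, mul_one]

end ChernHypersurface
end

theorem lemma2p3 (n d : ℕ) (hd : 1 ≤ d) (hdn : d ≤ n)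
    (F : MvPolynomial (Fin (n + 1)) ℂ) (hF : F.IsHomogeneous d)
    (hsmooth : ChernHypersurface.IsNonsingular F) (α : ℕ → ℕ → ℤ) :
    (ChernHypersurface.IsChernCoeff n d α →
      ∀ (φ : ChernHypersurface.LocalParam F (n - 1)), ∀ q, 1 ≤ q → q ≤ n - 1 → ∀ x ∈ φ.dom,
        ChernHypersurface.chernForm φ.metric q x =
          ∑ k ∈ Finset.range (q + 1), (α q k : ℂ) •
            (φ.kahlerForm x ^ k *
              ChernHypersurface.ddbar
                (fun y => (ChernHypersurface.xi F d (φ.lift y) : ℂ)) x ^ (q - k))) ∧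
    (ChernHypersurface.IsChernCoeff n d α ↔
      ∀ q ≤ n - 1, ∀ k ≤ q, α q k =
        (-1) ^ q * ∑ l ∈ Finset.range (k + 1),
          (-1) ^ l * (d : ℤ) ^ (k - l) * ((q - l).choose (k - l) : ℤ) *
            ((n + 1).choose l : ℤ)) := by
  refine ⟨fun hα φ q _ hq x hx => ?_, ChernHypersurface.isChernCoeff_iff n d α⟩
  obtain ⟨m, rfl⟩ : ∃ m, n = m + 1 := ⟨n - 1, by omega⟩
  change ChernHypersurface.LocalParam F m at φ
  induction q with
  | zero => simp [ChernHypersurface.chernForm_zero, hα.zero]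
  | succ q ih =>
    rw [hα.sum_eq _ _ hq, φ.chernForm_succ hd hF hsmooth hx (by omega)]
    -- The induction hypothesis carries `1 ≤ q`, so the step from `q = 0` uses `c_0 = 1 = α_{00}`
    -- directly.
    by_cases h : 1 ≤ q
    · rw [ih h (by omega)]; rfl
    · obtain rfl : q = 0 := by omega
      simp only [ChernHypersurface.chernForm_zero, Finset.sum_range_one, hα.zero, zero_add,
        Nat.sub_self, pow_zero, mul_one, Int.cast_one, one_smul]
      rfl
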